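/- Let $k$ be an algebraically closed field and let $K_0(\mathrm{Var}_k)$ be the Grothendieck ring of varieties over $k$. Let $(X,0)$ be a reduced curve singularity over $k$ with $s\ge 1$ branches, i.e. $X=\operatorname{Spec} R$ with $R$ a reduced complete Noetherian local $k$-algebra of dimension $1$ with residue field $k$, and identify its normalization with $\tilde R=\prod_{i=1}^s k[[x_i]]\supset R$. Write $\varphi_i: B_i=\operatorname{Spec}k[[x_i]]\to X$ for the restriction of the normalization map to the $i$-th branch. Let $\mathfrak c=\operatorname{Ann}_R(\tilde R/R)$ be the conductor ideal and let the conductor $c_i$ of the $i$-th branch be the least integer $c\ge 0$ such that $x_i^{c}\in\mathfrak c$, where $x_i^c$ denotes the element of $\tilde R$ with $i$-th component $x_i^c$ and all other components $0$. For $d\ge 0$ let $\operatorname{Hilb}^d(X,0)$ be the punctual Hilbert scheme, whose closed points are the ideals $\mathcal I\subset R$ of colength $d$, and for $\underline a\in\mathbb N^s$ let $\operatorname{Hilb}^{d,\underline a}(X,0)\subset\operatorname{Hilb}^d(X,0)$ be the locally closed subvariety of those $[\mathcal I]$ such that $\varphi_i^{*}\operatorname{Spec}(R/\mathcal I)$ has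 length $a_i$ for all $i=1,\dots,s$. Then for all $\underline a'=(a_1,\dots,a_{s-1})\in\mathbb N^{s-1}$, all $d\ge 0$ and all $e\ge c_s$, $$[\operatorname{Hilb}^{d,(\underline a',e)}(X,0)]=[\operatorname{Hilb}^{d+1,(\underline a',e+1)}(X,0)]\quad\text{in } K_0(\mathrm{Var}_k).$$ -/

import Mathlib

open CategoryTheory AlgebraicGeometry MonoidalCategory TopologicalSpace
open scoped PowerSeries

universe u v

/-! ### The Grothendieck ring of varieties -/

section GrothendieckRing

variable (k : Type u) [Field k]

/-- A `k`-scheme that is separated and of finite type. -/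
def IsVariety : ObjectProperty (Over (Spec (CommRingCat.of k))) := fun X =>
  IsSeparated X.hom ∧ LocallyOfFiniteType X.hom ∧ QuasiCompact X.hom

instance : (IsVariety k).IsMonoidal where
  prop_unit := by
    refine ⟨?_, ?_, ?_⟩ <;> (dsimp; infer_instance)
  prop_tensor X Y hX hY := by
    obtain ⟨_, _, _⟩ := hX
    obtain ⟨_, _, _⟩ := hY
    refine ⟨?_, ?_, ?_⟩ <;> (rw [Over.tensorObj_hom]; infer_instance)

/-- The category of varieties over `k` (separated `k`-schemes of finite type); its monoidal
structure is the fibre product over `k`. -/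
abbrev Var := (IsVariety k).FullSubcategory

/-- The free commutative ring on isomorphism classes of varieties, with `[X] * [Y] = [X ×ₖ Y]`. -/
abbrev PreK0 := MonoidAlgebra ℤ (Skeleton (Var k))

variable {k} in
/-- The generator attached to a variety. -/
noncomputable def PreK0.of (X : Var k) : PreK0 k := MonoidAlgebra.of ℤ _ (toSkeleton X)

/-- The scissor relations `[X] - [Z] - [U]`, for `Z` closed in `X` with open complement `U`. -/
def scissorRelations : Set (PreK0 k) :=
  {r | ∃ (X Z U : Var k) (i : Z ⟶ X) (j : U ⟶ X),
    IsClosedImmersion i.hom.left ∧ IsOpenImmersion j.hom.left ∧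
    IsCompl (Set.range i.hom.left) (Set.range j.hom.left) ∧
    r = PreK0.of X - PreK0.of Z - PreK0.of U}

/-- The Grothendieck ring of varieties over `k`. -/
abbrev K0Var := PreK0 k ⧸ Ideal.span (scissorRelations k)

variable {k} in
/-- The class of a variety in the Grothendieck ring. -/
noncomputable def K0Var.mk (X : Var k) : K0Var k := Ideal.Quotient.mk _ (PreK0.of X)

end GrothendieckRing

/-! ### Locally closed subvarieties of projective space -/

section Projective

variable (k : Type u) [Field k] (σ : Type) [Finite σ]

/-- The standard grading of `k[p_j : j ∈ σ]`. -/
abbrev coordGrading : ℕ → Submodule k (MvPolynomial σ k) := MvPolynomial.homogeneousSubmodule σ k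

attribute [local instance] MvPolynomial.gradedAlgebra

/-- The structure morphism of the projective space `Proj k[p_j : j ∈ σ]` over `k`. -/
noncomputable def projSpaceHom : Proj (coordGrading k σ) ⟶ Spec (CommRingCat.of k) :=
  Proj.toSpecZero (coordGrading k σ) ≫
    Spec.map (CommRingCat.ofHom (algebraMap k (coordGrading k σ 0)))

lemma isVariety_projSpace : IsSeparated (projSpaceHom k σ) ∧
    LocallyOfFiniteType (projSpaceHom k σ) ∧ QuasiCompact (projSpaceHom k σ) := by
  have hsurj : Function.Surjective (algebraMap k (coordGrading k σ 0)) := by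
    rintro ⟨f, hf⟩
    rw [coordGrading, MvPolynomial.mem_homogeneousSubmodule,
      ← MvPolynomial.totalDegree_zero_iff_isHomogeneous] at hf
    refine ⟨MvPolynomial.coeff 0 f, Subtype.ext ?_⟩
    exact (MvPolynomial.totalDegree_eq_zero_iff_eq_C.mp hf).symm
  have : IsClosedImmersion
      (Spec.map (CommRingCat.ofHom (algebraMap k (coordGrading k σ 0)))) :=
    IsClosedImmersion.spec_of_surjective _ hsurj
  have : IsScalarTower k (coordGrading k σ 0) (MvPolynomial σ k) :=
    IsScalarTower.of_algebraMap_eq' (R := k) (S := coordGrading k σ 0) (A := MvPolynomial σ k) rfl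
  have : Algebra.FiniteType (coordGrading k σ 0) (MvPolynomial σ k) :=
    Algebra.FiniteType.of_restrictScalars_finiteType k _ _
  refine ⟨?_, ?_, ?_⟩ <;> (dsimp only [projSpaceHom]; infer_instance)

variable {k σ}

/-- The point `x` of projective space is the `k`-rational point with homogeneous coordinates `p`:
a homogeneous polynomial vanishes at `x` iff it vanishes at `p`. -/
def HasHomogeneousCoords (x : Proj (coordGrading k σ)) (p : σ → k) : Prop :=
  ∀ (n : ℕ), ∀ f ∈ coordGrading k σ n,
    f ∈ (show ProjectiveSpectrum (coordGrading k σ) from x).asHomogeneousIdeal ↔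
      MvPolynomial.eval p f = 0

/-- For a set `D` of closed points, the closed set of boundary points: the closure of the
closed points that are in the closure of `D` but not in `D`. -/
def boundaryOf {X : Scheme.{u}} (D : Set X) : Closeds X :=
  ⟨closure ({x | x ∈ closure D ∧ IsClosed {x}} \ D), isClosed_closure⟩

/-- The open complement of `boundaryOf D`. -/
def complOf {X : Scheme.{u}} (D : Set X) : X.Opens := (boundaryOf D).compl

/-- For a set `D` of closed points that is locally closed among the closed points: the
locally closed subset `closure D \ boundaryOf D`, whose closed points are the elements of `D`,
with its reduced scheme structure. It is a closed subscheme of the open complement of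
`boundaryOf D`. -/
noncomputable def reducedSubscheme {X : Scheme.{u}} (D : Set X) : Scheme.{u} :=
  (Scheme.IdealSheafData.vanishingIdeal
    ((Closeds.closure D).preimage ((complOf D).ι).continuous)).subscheme

/-- The inclusion of `reducedSubscheme D`. -/
noncomputable def reducedSubschemeι {X : Scheme.{u}} (D : Set X) : reducedSubscheme D ⟶ X :=
  (Scheme.IdealSheafData.vanishingIdeal
    ((Closeds.closure D).preimage ((complOf D).ι).continuous)).subschemeι ≫
    (complOf D).ι

instance {X : Scheme.{u}} (D : Set X) : IsImmersion (reducedSubschemeι D) :=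
  inferInstanceAs (IsImmersion ((Scheme.IdealSheafData.vanishingIdeal
    ((Closeds.closure D).preimage ((complOf D).ι).continuous)).subschemeι ≫ (complOf D).ι))

/-- The variety of a locally closed set `D` of closed points of projective space. -/
noncomputable def subvariety (D : Set (Proj (coordGrading k σ))) : Var k where
  obj := Over.mk (reducedSubschemeι D ≫ projSpaceHom k σ)
  property := by
    obtain ⟨_, _, _⟩ := isVariety_projSpace k σ
    have : IsLocallyNoetherian (Proj (coordGrading k σ)) :=
      LocallyOfFiniteType.isLocallyNoetherian (projSpaceHom k σ)
    have : CompactSpace (Proj (coordGrading k σ)) :=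
      QuasiCompact.compactSpace_of_compactSpace (projSpaceHom k σ)
    have : IsNoetherian (Proj (coordGrading k σ)) := {}
    have : QuasiCompact (reducedSubschemeι D) :=
      have := (reducedSubschemeι D).isEmbedding.isInducing.noetherianSpace
      inferInstance
    refine ⟨?_, ?_, ?_⟩ <;> (dsimp only [Over.mk_hom]; infer_instance)

end Projective

/-! ### Curve singularities, branches and conductors -/

section Curve

variable (k : Type u) [Field k] (R : Type v) [CommRing R] [Algebra k R]

attribute [local instance] MvPolynomial.gradedAlgebra

/-- `R` is the complete local ring of a reduced curve singularity over `k`: a reduced complete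
Noetherian local `k`-algebra of dimension one with residue field `k`. -/
class IsCurveSingularity : Prop extends IsLocalRing R, IsNoetherianRing R, IsReduced R where
  isAdicComplete : IsAdicComplete (IsLocalRing.maximalIdeal R) R
  ringKrullDim_eq : ringKrullDim R = 1
  residue_bijective : Function.Bijective (algebraMap k (IsLocalRing.ResidueField R))

/-- The normalization of a curve singularity with `s` branches, the normalization being identified
with `k⟦x₁⟧ × ⋯ × k⟦xₛ⟧` : an injective, integral and birational `k`-algebra map. (The target is
integrally closed in its total ring of fractions, so it is the integral closure of `R` in its
total ring of fractions.) -/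
structure Normalization (s : ℕ) where
  toAlgHom : R →ₐ[k] (Fin s → k⟦X⟧)
  injective : Function.Injective toAlgHom
  isIntegral : toAlgHom.toRingHom.IsIntegral
  birational : ∀ y : Fin s → k⟦X⟧, ∃ a b : R,
    toAlgHom b ∈ nonZeroDivisors (Fin s → k⟦X⟧) ∧ toAlgHom b * y = toAlgHom a

namespace Normalization

variable {k R} {s : ℕ} (φ : Normalization k R s)

/-- The restriction of the normalization map to the `i`-th branch. -/
noncomputable def branch (i : Fin s) : R →+* k⟦X⟧ :=
  (Pi.evalRingHom (fun _ : Fin s => k⟦X⟧) i).comp φ.toAlgHom.toRingHom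

/-- The conductor ideal: the annihilator in `R` of the quotient of the normalization by `R`. -/
def conductorIdeal : Ideal R where
  carrier := {r | ∀ y : Fin s → k⟦X⟧, φ.toAlgHom r * y ∈ φ.toAlgHom.range}
  zero_mem' y := by simp
  add_mem' {a b} ha hb y := by
    rw [map_add, add_mul]
    exact add_mem (ha y) (hb y)
  smul_mem' c r hr y := by
    rw [smul_eq_mul, map_mul, mul_assoc]
    exact mul_mem ⟨c, rfl⟩ (hr y)

/-- The conductor `cᵢ` of the `i`-th branch: the least `c` such that `xᵢ ^ c` lies in the
conductor ideal, where `xᵢ ^ c` denotes the element with `i`-th component `xᵢ ^ c` and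
all other components `0`. -/
noncomputable def branchConductor (i : Fin s) : ℕ :=
  sInf {c | ∃ r ∈ φ.conductorIdeal, φ.toAlgHom r = Pi.single i (PowerSeries.X ^ c)}

/-- `I` has branch-length vector `a`: for every branch `Bᵢ → Spec R`, the pullback of the closed
subscheme `Spec (R / I)` to `Bᵢ` has length `aᵢ`. -/
def HasBranchLength (I : Ideal R) (a : Fin s → ℕ) : Prop :=
  ∀ i, Module.length k⟦X⟧ (k⟦X⟧ ⧸ I.map (φ.branch i)) = a i

end Normalization

/-! ### The branch-length strata of the punctual Hilbert scheme -/

variable [IsCurveSingularity k R]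

instance finite_quotient_pow (d : ℕ) :
    Module.Finite k (R ⧸ IsLocalRing.maximalIdeal R ^ d) := by
  classical
  set m := IsLocalRing.maximalIdeal R with hm
  have hdec : ∀ r : R, ∃ c : k, r - algebraMap k R c ∈ m := fun r => by
    obtain ⟨c, hc⟩ := (IsCurveSingularity.residue_bijective (k := k) (R := R)).2
      (IsLocalRing.residue R r)
    refine ⟨c, ?_⟩
    rw [hm, ← IsLocalRing.residue_eq_zero_iff, map_sub, ← hc, sub_eq_zero]
    rfl
  have key : ∀ n : ℕ, ∃ S : Finset R,
      Submodule.span k (S : Set R) ⊔ (m ^ n).restrictScalars k = ⊤ := by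
    intro n
    induction n with
    | zero => exact ⟨∅, by simp [Ideal.one_eq_top]⟩
    | succ n ih =>
      obtain ⟨S, hS⟩ := ih
      obtain ⟨G, hG⟩ := (IsNoetherian.noetherian (m ^ n) : (m ^ n).FG)
      refine ⟨S ∪ G, ?_⟩
      have hle : (m ^ n).restrictScalars k ≤
          Submodule.span k (G : Set R) ⊔ (m ^ (n + 1)).restrictScalars k := by
        intro x hx
        have hx' : x ∈ Submodule.span R (G : Set R) := by rw [hG]; exact hx
        induction hx' using Submodule.span_induction with
        | mem x h => exact Submodule.mem_sup_left (Submodule.subset_span h)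
        | zero => exact zero_mem _
        | add x y hx1 hy1 h1 h2 =>
          exact add_mem (h1 (by rw [hG] at hx1; exact hx1)) (h2 (by rw [hG] at hy1; exact hy1))
        | smul r x hx1 h1 =>
          have hxm : x ∈ m ^ n := by rw [hG] at hx1; exact hx1
          obtain ⟨c, hc⟩ := hdec r
          have e : r • x = c • x + (r - algebraMap k R c) * x := by
            rw [Algebra.smul_def c x, smul_eq_mul]; ring
          rw [e]
          refine add_mem (Submodule.smul_mem _ c (h1 hxm)) (Submodule.mem_sup_right ?_)
          change _ ∈ m ^ (n + 1)
          rw [pow_succ']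
          exact Ideal.mul_mem_mul hc hxm
      rw [eq_top_iff, ← hS, Finset.coe_union, Submodule.span_union, sup_assoc]
      exact sup_le_sup_left hle _
  obtain ⟨S, hS⟩ := key d
  refine ⟨⟨S.image (Ideal.Quotient.mkₐ k (m ^ d)), ?_⟩⟩
  have h1 := congrArg (Submodule.map (Ideal.Quotient.mkₐ k (m ^ d)).toLinearMap) hS
  rw [Submodule.map_sup, Submodule.map_top, LinearMap.range_eq_top.mpr
    (Ideal.Quotient.mkₐ_surjective k (m ^ d))] at h1
  have h2 : Submodule.map (Ideal.Quotient.mkₐ k (m ^ d)).toLinearMap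
      ((m ^ d).restrictScalars k) = ⊥ := by
    rw [eq_bot_iff]
    rintro _ ⟨x, hx, rfl⟩
    exact Ideal.Quotient.eq_zero_iff_mem.mpr hx
  rw [h2, sup_bot_eq, Submodule.map_span] at h1
  simpa using h1

/-- Elements of `R` whose classes form a `k`-basis of `R / 𝔪 ^ d`. -/
noncomputable def frame (d : ℕ) :
    Fin (Module.finrank k (R ⧸ IsLocalRing.maximalIdeal R ^ d)) → R := fun i =>
  Function.surjInv Ideal.Quotient.mk_surjective
    (Module.finBasis k (R ⧸ IsLocalRing.maximalIdeal R ^ d) i)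

/-- Index set of the Plücker coordinates for `d`-dimensional quotients of `R / 𝔪 ^ d`
(all `d`-tuples of basis vectors, so the coordinates are alternating in the index). -/
abbrev PluckerIndex (d : ℕ) : Type :=
  Fin d → Fin (Module.finrank k (R ⧸ IsLocalRing.maximalIdeal R ^ d))

variable {R}

/-- The Plücker coordinates of the quotient `R → R / I` with respect to a volume form
on the `d`-dimensional space `R / I`. -/
noncomputable def pluckerCoords {d : ℕ} (I : Ideal R) (ω : (R ⧸ I) [⋀^Fin d]→ₗ[k] k) :
    PluckerIndex k R d → k :=
  fun j => ω fun l => Ideal.Quotient.mk I (frame k R d (j l))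

variable {k}

/-- The closed points of the stratum of the punctual Hilbert scheme: the points `[I]` for the ideals
`I` of colength `d` with branch-length vector `a`. Such an ideal contains `𝔪 ^ d`,
so `R / I` is a `d`-dimensional quotient of the vector space `R / 𝔪 ^ d` and `[I]` is its
point on the Grassmannian of these quotients in the Plücker embedding. -/
def hilbStratumPoints {s : ℕ} (φ : Normalization k R s) (d : ℕ) (a : Fin s → ℕ) :
    Set (Proj (coordGrading k (PluckerIndex k R d))) :=
  {x | ∃ I : Ideal R, Module.length R (R ⧸ I) = d ∧ φ.HasBranchLength I a ∧
    ∃ ω : (R ⧸ I) [⋀^Fin d]→ₗ[k] k, ω ≠ 0 ∧ HasHomogeneousCoords x (pluckerCoords k I ω)}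

/-- The stratum of the punctual Hilbert scheme of length `d` subschemes with branch-length
vector `a`, as a (reduced) locally closed subvariety of the Grassmannian of `d`-dimensional
quotients of `R / 𝔪 ^ d`. -/
noncomputable def hilbStratum {s : ℕ} (φ : Normalization k R s) (d : ℕ) (a : Fin s → ℕ) : Var k :=
  subvariety (hilbStratumPoints φ d a)

end Curve

/-! The two strata are isomorphic as varieties, so their classes agree. Since `e` is at least the
conductor of the branch `i`, every `xᵢᵉ g` lies in `R` (`exists_eq_single_X_pow_mul`). Hence `R` has
a `k`-linear endomorphism that keeps the coefficients of index `< e` along the branch and multiplies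
the rest of that component by `xᵢ` (`nonempty_branchShift`). It is injective with cokernel spanned
by `ε = xᵢᵉ`, and on elements of order `≥ e` it is multiplication by `(1, …, xᵢ, …, 1)`. An ideal of
branch length `e` has only such elements, so its image `J` is again an ideal, of branch length `e +
1`; every ideal of that branch length arises once. As `R/J ≅ k ε ⊕ R/I`, the colength grows by one.

The bijection is algebraic because it is linear in Plücker coordinates: a volume form `ω` on `R/I`
goes to its pullback wedged with the `e`-th coefficient, and contraction with `ε` is the inverse
(`pluckerMap_pluckerCoords`, `pluckerMapInv_pluckerCoords`). Two linear maps that are inverse to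
each other on sets of rational points give isomorphic reduced subvarieties, by comparing graphs in a
larger projective space (`nonempty_iso_subvariety_of_linearMap`). -/

/-! ### Reduced locally closed subschemes under closed immersions. -/

section ReducedSubscheme

variable {X Y : Scheme.{u}}

lemma boundaryOf_image (i : X ⟶ Y) [IsClosedImmersion i] (D : Set X) :
    (boundaryOf (i '' D) : Set Y) = i '' (boundaryOf D : Set X) := by
  have hi := i.isClosedEmbedding
  change closure _ = i '' closure _
  rw [← hi.closure_image_eq, Set.image_sdiff hi.injective]
  congr 2
  ext y
  constructor
  · rintro ⟨hy, hy'⟩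
    rw [hi.closure_image_eq] at hy
    obtain ⟨x, hx, rfl⟩ := hy
    refine ⟨x, ⟨hx, ?_⟩, rfl⟩
    have h := hy'.preimage hi.continuous
    rwa [← Set.image_singleton, hi.injective.preimage_image] at h
  · rintro ⟨x, ⟨hx, hx'⟩, rfl⟩
    refine ⟨?_, ?_⟩
    · rw [hi.closure_image_eq]
      exact ⟨x, hx, rfl⟩
    · rw [← Set.image_singleton]
      exact hi.isClosedMap _ hx'

lemma complOf_eq_preimage (i : X ⟶ Y) [IsClosedImmersion i] (D : Set X) :
    complOf D = i ⁻¹ᵁ complOf (i '' D) := by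
  ext x
  change x ∈ (boundaryOf D : Set X)ᶜ ↔ i x ∈ (boundaryOf (i '' D) : Set Y)ᶜ
  rw [boundaryOf_image, Set.mem_compl_iff, Set.mem_compl_iff,
    i.isClosedEmbedding.injective.mem_set_image]

/-- Both sides are closed subschemes of `V` with the same ideal, because the pushforward of a
vanishing ideal is the vanishing ideal of the closure of the image. `U` is kept as a variable since
`complOf D` is a preimage only up to a propositional equality. -/
lemma exists_iso_subscheme_vanishingIdeal (i : X ⟶ Y) [IsClosedImmersion i] (D : Set X)
    (V : Y.Opens) (U : X.Opens) (h : U = i ⁻¹ᵁ V) :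
    ∃ e : (Scheme.IdealSheafData.vanishingIdeal
          ((Closeds.closure D).preimage U.ι.continuous)).subscheme ≅
        (Scheme.IdealSheafData.vanishingIdeal
          ((Closeds.closure (i '' D)).preimage V.ι.continuous)).subscheme,
      e.hom ≫ (Scheme.IdealSheafData.vanishingIdeal
          ((Closeds.closure (i '' D)).preimage V.ι.continuous)).subschemeι ≫ V.ι =
        ((Scheme.IdealSheafData.vanishingIdeal
          ((Closeds.closure D).preimage U.ι.continuous)).subschemeι ≫ U.ι) ≫ i := by
  subst h
  set Z := (Closeds.closure D).preimage (i ⁻¹ᵁ V).ι.continuous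
  set Z' := (Closeds.closure (i '' D)).preimage V.ι.continuous
  let f := (Scheme.IdealSheafData.vanishingIdeal Z).subschemeι ≫ (i ∣_ V)
  have hZ : Closeds.closure ((i ∣_ V) '' (Z : Set _)) = Z' := by
    have hc (x : (i ⁻¹ᵁ V).toScheme) : V.ι ((i ∣_ V) x) = i ((i ⁻¹ᵁ V).ι x) := by
      rw [← Scheme.Hom.comp_apply, ← Scheme.Hom.comp_apply, morphismRestrict_ι]
    have himage : ((i ∣_ V) '' (Z : Set _)) = (Z' : Set _) := by
      ext v
      change _ ↔ V.ι v ∈ closure (i '' D)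
      rw [i.isClosedEmbedding.closure_image_eq]
      constructor
      · rintro ⟨x, hx, rfl⟩
        exact ⟨(i ⁻¹ᵁ V).ι x, hx, (hc x).symm⟩
      · rintro ⟨x, hx, hxv⟩
        have hxV : i x ∈ V := by rw [hxv]; exact v.2
        refine ⟨⟨x, hxV⟩, hx, V.ι.isOpenEmbedding.injective ?_⟩
        exact (hc _).trans hxv
    rw [himage]
    exact SetLike.coe_injective Z'.isClosed.closure_eq
  have hker : (Scheme.IdealSheafData.vanishingIdeal Z').subschemeι.ker = f.ker := by
    rw [Scheme.Hom.ker_comp, Scheme.IdealSheafData.ker_subschemeι,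
      Scheme.IdealSheafData.ker_subschemeι, Scheme.IdealSheafData.map_vanishingIdeal, hZ]
  have := IsClosedImmersion.isIso_lift _ _ hker
  refine ⟨asIso (IsClosedImmersion.lift _ _ hker.le), ?_⟩
  rw [asIso_hom, IsClosedImmersion.lift_fac_assoc]
  simp [f]

lemma exists_iso_reducedSubscheme_image (i : X ⟶ Y) [IsClosedImmersion i] (D : Set X) :
    ∃ e : reducedSubscheme D ≅ reducedSubscheme (i '' D),
      e.hom ≫ reducedSubschemeι (i '' D) = reducedSubschemeι D ≫ i :=
  exists_iso_subscheme_vanishingIdeal i D _ _ (complOf_eq_preimage i D)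

end ReducedSubscheme

/-! ### Closed immersions of Proj from graded surjections. -/

section ProjMap

open HomogeneousLocalization

variable {A B σ τ : Type u} [CommRing A] [SetLike σ A] [AddSubgroupClass σ A]
  [CommRing B] [SetLike τ B] [AddSubgroupClass τ B]
  {𝒜 : ℕ → σ} {ℬ : ℕ → τ} [GradedRing 𝒜] [GradedRing ℬ]

lemma AlgebraicGeometry.isClosedImmersion_morphismRestrict {X Y : Scheme.{u}} (g : X ⟶ Y)
    (U : Y.Opens) (hU : IsAffineOpen U) (hU' : IsAffineOpen (g ⁻¹ᵁ U))
    (h : Function.Surjective (g.app U)) : IsClosedImmersion (g ∣_ U) := by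
  have : IsAffine U := hU
  have : IsAffine (g ⁻¹ᵁ U) := hU'
  -- The sections of `g ∣_ U` live over opens only propositionally equal to `U` and its preimage.
  have key (V : Y.Opens) (W : X.Opens) (e : W ≤ g ⁻¹ᵁ V) (hV : V = U) (hW : W = g ⁻¹ᵁ U) :
      Function.Surjective (g.appLE V W e) := by
    subst hV hW
    rwa [← Scheme.Hom.app_eq_appLE]
  refine IsClosedImmersion.of_surjective_of_isAffine _ ?_
  rw [Scheme.Hom.appTop, morphismRestrict_app']
  exact key _ _ _ (by simp) (by simp)

/-- On `D₊(s)` the map is that of degree-zero localizations, where a fraction `b / f(s)ⁿ` lifts by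
lifting its numerator in the same degree. -/
lemma AlgebraicGeometry.Proj.map_app_basicOpen_surjective (f : 𝒜 →+*ᵍ ℬ)
    (hf : HomogeneousIdeal.irrelevant ℬ ≤ (HomogeneousIdeal.irrelevant 𝒜).map f)
    (hsurj : ∀ n, ∀ b ∈ ℬ n, ∃ a ∈ 𝒜 n, f a = b) {m : ℕ} (hm : 0 < m) {s : A} (hs : s ∈ 𝒜 m) :
    Function.Surjective ((Proj.map f hf).app (Proj.basicOpen 𝒜 s)) := by
  have h := Proj.awayToSection_comp_appLE f hf hs
  have hfs : f s ∈ ℬ m := f.2 hs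
  have h1 : IsIso (Proj.awayToSection 𝒜 s) := by
    rw [← Proj.basicOpenIsoAway_hom 𝒜 s hs hm]; infer_instance
  have h2 : IsIso (Proj.awayToSection ℬ (f s)) := by
    rw [← Proj.basicOpenIsoAway_hom ℬ (f s) hfs hm]; infer_instance
  have hmap : Function.Surjective (Away.map f s) := by
    intro y
    obtain ⟨n, b, hb, rfl⟩ := Away.mk_surjective ℬ hfs y
    obtain ⟨a, ha, rfl⟩ := hsurj _ b hb
    exact ⟨Away.mk 𝒜 hs n a ha, Away.map_mk f _ hs n a ha⟩
  rw [Scheme.Hom.app_eq_appLE]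
  change Function.Surjective ((Proj.map f hf).appLE (Proj.basicOpen 𝒜 s)
    (Proj.basicOpen ℬ (f s)) le_rfl)
  intro y
  obtain ⟨z, rfl⟩ := (ConcreteCategory.bijective_of_isIso (Proj.awayToSection ℬ (f s))).2 y
  obtain ⟨w, rfl⟩ := hmap z
  exact ⟨Proj.awayToSection 𝒜 s w, ConcreteCategory.congr_hom h w⟩

lemma AlgebraicGeometry.Proj.isClosedImmersion_map (f : 𝒜 →+*ᵍ ℬ)
    (hf : HomogeneousIdeal.irrelevant ℬ ≤ (HomogeneousIdeal.irrelevant 𝒜).map f)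
    (hsurj : ∀ n, ∀ b ∈ ℬ n, ∃ a ∈ 𝒜 n, f a = b) :
    IsClosedImmersion (Proj.map f hf) := by
  refine IsZariskiLocalAtTarget.of_iSup_eq_top (P := @IsClosedImmersion)
    (fun s : Σ i : ℕ+, 𝒜 i => Proj.basicOpen 𝒜 (s.2 : A)) ?_ fun s => ?_
  · refine Proj.iSup_basicOpen_eq_top 𝒜 (fun s : Σ i : ℕ+, 𝒜 i => (s.2 : A)) ?_
    refine (HomogeneousIdeal.toIdeal_irrelevant_le _).mpr fun i hi x hx ↦ ?_
    exact Ideal.subset_span ⟨⟨⟨i, hi⟩, ⟨x, hx⟩⟩, rfl⟩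
  · exact isClosedImmersion_morphismRestrict _ _ (Proj.isAffineOpen_basicOpen 𝒜 _ s.2.2 s.1.2)
      (Proj.isAffineOpen_basicOpen ℬ (f s.2) (f.2 s.2.2) s.1.2)
      (Proj.map_app_basicOpen_surjective f hf hsurj s.1.2 s.2.2)

end ProjMap

/-! ### Linear maps of homogeneous coordinates. -/

section LinearMaps

variable {k : Type u} [Field k] {σ τ : Type}

attribute [local instance] MvPolynomial.gradedAlgebra

lemma HasHomogeneousCoords.unique {x y : Proj (coordGrading k σ)} {p : σ → k}
    (hx : HasHomogeneousCoords x p) (hy : HasHomogeneousCoords y p) : x = y := by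
  exact ProjectiveSpectrum.ext
    (HomogeneousIdeal.ext' fun n f hf => (hx n f hf).trans (hy n f hf).symm)

lemma HasHomogeneousCoords.ne_zero {x : Proj (coordGrading k σ)} {p : σ → k}
    (hx : HasHomogeneousCoords x p) : p ≠ 0 := by
  rintro rfl
  refine ProjectiveSpectrum.not_irrelevant_le x ?_
  rw [HomogeneousIdeal.irrelevant_le]
  intro n hn f hf
  refine (hx n f hf).2 ?_
  have hf' : f.IsHomogeneous n := hf
  rw [MvPolynomial.eval_zero, MvPolynomial.constantCoeff_eq]
  exact hf'.coeff_eq_zero (by simpa using hn.ne)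

lemma exists_hasHomogeneousCoords {p : σ → k} (hp : p ≠ 0) :
    ∃ x : Proj (coordGrading k σ), HasHomogeneousCoords x p := by
  set I : Ideal (MvPolynomial σ k) := RingHom.ker (MvPolynomial.eval p)
  have hI : I.IsPrime := RingHom.ker_isPrime _
  refine ⟨⟨I.homogeneousCore (coordGrading k σ), hI.homogeneousCore, fun h => ?_⟩, ?_⟩
  · obtain ⟨j, hj⟩ := Function.ne_iff.1 hp
    have hX : MvPolynomial.X j ∈ coordGrading k σ 1 := MvPolynomial.isHomogeneous_X k j
    have := Ideal.toIdeal_homogeneousCore_le (coordGrading k σ) I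
      (h (HomogeneousIdeal.mem_irrelevant_of_mem _ one_pos hX))
    exact hj (by simpa [I] using this)
  · intro n f hf
    refine ⟨fun h => Ideal.toIdeal_homogeneousCore_le (coordGrading k σ) I h, fun h => ?_⟩
    exact Ideal.mem_homogeneousCore_of_homogeneous_of_mem ⟨n, hf⟩ h

variable [Fintype σ] [DecidableEq σ]

open MvPolynomial in
/-- Substitution of a linear map into polynomials. -/
noncomputable def linearSubst (S : (σ → k) →ₗ[k] (τ → k)) :
    MvPolynomial τ k →ₐ[k] MvPolynomial σ k :=
  aeval fun t => ∑ i, C (S (Pi.single i 1) t) * X i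

lemma eval_linearSubst (S : (σ → k) →ₗ[k] (τ → k)) (p : σ → k) (f : MvPolynomial τ k) :
    MvPolynomial.eval p (linearSubst S f) = MvPolynomial.eval (S p) f := by
  have h : ((MvPolynomial.aeval p).comp (linearSubst S) : MvPolynomial τ k →ₐ[k] k) =
      MvPolynomial.aeval (S p) := by
    ext t
    simp only [linearSubst, AlgHom.comp_apply, MvPolynomial.aeval_X, map_sum, map_mul,
      MvPolynomial.aeval_C]
    conv_rhs => rw [LinearMap.pi_apply_eq_sum_univ S p]
    simp only [Finset.sum_apply, Pi.smul_apply, smul_eq_mul, Algebra.algebraMap_self_apply]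
    refine Finset.sum_congr rfl fun i _ => ?_
    rw [mul_comm]
    congr 2
    refine congrFun (congrArg S (funext fun j => ?_)) t
    simp [Pi.single_apply, eq_comm]
  simpa [MvPolynomial.aeval_eq_eval] using DFunLike.congr_fun h f

lemma linearSubst_mem (S : (σ → k) →ₗ[k] (τ → k)) {n : ℕ} {f : MvPolynomial τ k}
    (hf : f ∈ coordGrading k τ n) : linearSubst S f ∈ coordGrading k σ n := by
  rw [MvPolynomial.mem_homogeneousSubmodule] at hf ⊢
  have h := hf.aeval (S := k) (n := 1) 
    (fun t => ∑ i, MvPolynomial.C (S (Pi.single i 1) t) * MvPolynomial.X i : τ → MvPolynomial σ k)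
    fun t => MvPolynomial.IsHomogeneous.sum _ _ _ fun i _ => by
      simpa using (MvPolynomial.isHomogeneous_C _ _).mul (MvPolynomial.isHomogeneous_X k i)
  simpa [linearSubst, MvPolynomial.aeval_eq_bind₁] using h

/-- Substitution of a linear map as a homomorphism of graded rings. -/
noncomputable def gradedLinearSubst (S : (σ → k) →ₗ[k] (τ → k)) :
    coordGrading k τ →+*ᵍ coordGrading k σ where
  toRingHom := (linearSubst S).toRingHom
  map_mem := linearSubst_mem S

lemma awayι_comp_map_comp_projSpaceHom (S : (σ → k) →ₗ[k] (τ → k))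
    (hirr : HomogeneousIdeal.irrelevant (coordGrading k σ) ≤
      (HomogeneousIdeal.irrelevant (coordGrading k τ)).map (gradedLinearSubst S))
    {n : ℕ} (hn : 0 < n) (f : MvPolynomial τ k) (hf : f ∈ coordGrading k τ n) :
    Proj.awayι (coordGrading k σ) (gradedLinearSubst S f) ((gradedLinearSubst S).2 hf) hn ≫
        Proj.map (gradedLinearSubst S) hirr ≫ projSpaceHom k τ =
      Proj.awayι (coordGrading k σ) (gradedLinearSubst S f) ((gradedLinearSubst S).2 hf) hn ≫
        projSpaceHom k σ := by
  rw [projSpaceHom, projSpaceHom, Proj.awayι_comp_map_assoc _ _ hn _ hf,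
    Proj.awayι_toSpecZero_assoc,
    Proj.awayι_toSpecZero_assoc, ← Spec.map_comp, ← Spec.map_comp, ← Spec.map_comp]
  congr 1
  ext c
  change Localization.mk (linearSubst S (algebraMap k _ c)) ⟨linearSubst S 1, _⟩ =
    Localization.mk (algebraMap k _ c) ⟨1, _⟩
  simp only [map_one, AlgHom.commutes]

variable [Fintype τ] [DecidableEq τ]

/-- Over an infinite field a polynomial identity can be checked on values. -/
lemma linearSubst_linearSubst_of_leftInverse [Infinite k] (S : (σ → k) →ₗ[k] (τ → k))
    (L : (τ → k) →ₗ[k] (σ → k)) (hLS : ∀ p, L (S p) = p) (f : MvPolynomial σ k) :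
    linearSubst S (linearSubst L f) = f :=
  MvPolynomial.funext fun p => by rw [eval_linearSubst, eval_linearSubst, hLS]

/-- The left inverse makes substitution of `S` surjective in every degree, which yields both the
condition on irrelevant ideals and the closed immersion. -/
lemma exists_closedImmersion_of_leftInverse [Infinite k] (S : (σ → k) →ₗ[k] (τ → k))
    (L : (τ → k) →ₗ[k] (σ → k)) (hLS : ∀ p, L (S p) = p) :
    ∃ i : Proj (coordGrading k σ) ⟶ Proj (coordGrading k τ), IsClosedImmersion i ∧
      i ≫ projSpaceHom k τ = projSpaceHom k σ ∧
      ∀ x p, HasHomogeneousCoords x p → HasHomogeneousCoords (i x) (S p) := by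
  have hsurj : ∀ n, ∀ b ∈ coordGrading k σ n, ∃ a ∈ coordGrading k τ n,
      gradedLinearSubst S a = b := fun n b hb =>
    ⟨linearSubst L b, linearSubst_mem L hb, linearSubst_linearSubst_of_leftInverse S L hLS b⟩
  have hirr : HomogeneousIdeal.irrelevant (coordGrading k σ) ≤
      (HomogeneousIdeal.irrelevant (coordGrading k τ)).map (gradedLinearSubst S) := by
    rw [HomogeneousIdeal.irrelevant_le]
    intro n hn b hb
    obtain ⟨a, ha, rfl⟩ := hsurj n b hb
    exact Ideal.mem_map_of_mem _ (HomogeneousIdeal.mem_irrelevant_of_mem _ hn ha)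
  refine ⟨Proj.map (gradedLinearSubst S) hirr, Proj.isClosedImmersion_map _ _ hsurj, ?_, ?_⟩
  · exact (Proj.mapAffineOpenCover _ hirr).openCover.hom_ext _ _ fun s ↦
      awayι_comp_map_comp_projSpaceHom S hirr s.1.2 s.2 s.2.2
  · intro x p h n f hf
    rw [← eval_linearSubst]
    exact h n _ (linearSubst_mem S hf)

lemma nonempty_iso_subvariety_image {σ τ : Type} [Finite σ] [Finite τ]
    (i : Proj (coordGrading k σ) ⟶ Proj (coordGrading k τ)) [IsClosedImmersion i]
    (hi : i ≫ projSpaceHom k τ = projSpaceHom k σ) (D : Set (Proj (coordGrading k σ))) :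
    Nonempty (subvariety D ≅ subvariety (i '' D)) := by
  obtain ⟨e, he⟩ := exists_iso_reducedSubscheme_image i D
  refine ⟨(IsVariety k).isoMk (Over.isoMk e ?_)⟩
  change e.hom ≫ reducedSubschemeι (i '' D) ≫ projSpaceHom k τ =
    reducedSubschemeι D ≫ projSpaceHom k σ
  rw [reassoc_of% he, hi]

/-- Sets of rational points of two projective spaces that correspond to each other under linear
maps of the coordinates define isomorphic subvarieties. -/
lemma nonempty_iso_subvariety_of_linearMap [Infinite k] (T : (σ → k) →ₗ[k] (τ → k))
    (T' : (τ → k) →ₗ[k] (σ → k)) (P : Set (σ → k)) (P' : Set (τ → k))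
    (hT : ∀ p ∈ P, T p ∈ P' ∧ T' (T p) = p) (hT' : ∀ p ∈ P', T' p ∈ P ∧ T (T' p) = p) :
    Nonempty (subvariety {x | ∃ p ∈ P, HasHomogeneousCoords x p} ≅
      subvariety {x | ∃ p ∈ P', HasHomogeneousCoords x p}) := by
  classical
  -- `T` and `T'` may have kernels, so they need not define morphisms of projective spaces. The
  -- graphs `p ↦ (p, T p)` and `q ↦ (T' q, q)` have linear left inverses, and they send the two
  -- point sets to the same set.
  let S : (σ → k) →ₗ[k] (σ ⊕ τ → k) :=
    LinearMap.pi (Sum.elim LinearMap.proj (fun t => LinearMap.proj t ∘ₗ T))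
  let S' : (τ → k) →ₗ[k] (σ ⊕ τ → k) :=
    LinearMap.pi (Sum.elim (fun s => LinearMap.proj s ∘ₗ T') LinearMap.proj)
  have hS (p) : S p = Sum.elim p (T p) := by
    ext (j | j) <;> rfl
  have hS' (p) : S' p = Sum.elim (T' p) p := by
    ext (j | j) <;> rfl
  obtain ⟨i, hi, hik, hi'⟩ := exists_closedImmersion_of_leftInverse S
    (LinearMap.funLeft k k Sum.inl) (fun p => by rw [hS]; rfl)
  obtain ⟨i', hi2, hik', hi2'⟩ := exists_closedImmersion_of_leftInverse S'
    (LinearMap.funLeft k k Sum.inr) (fun p => by rw [hS']; rfl)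
  have himage : i '' {x | ∃ p ∈ P, HasHomogeneousCoords x p} =
      i' '' {x | ∃ p ∈ P', HasHomogeneousCoords x p} := by
    apply subset_antisymm
    · rintro _ ⟨x, ⟨p, hp, hx⟩, rfl⟩
      obtain ⟨hTp, hTT⟩ := hT p hp
      obtain ⟨y, hy⟩ := exists_hasHomogeneousCoords (p := T p) fun h => hx.ne_zero (by
        rw [← hTT, h, map_zero])
      refine ⟨y, ⟨T p, hTp, hy⟩, (hi2' _ _ hy).unique ?_⟩
      rw [hS', hTT, ← hS]
      exact hi' _ _ hx
    · rintro _ ⟨x, ⟨p, hp, hx⟩, rfl⟩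
      obtain ⟨hTp, hTT⟩ := hT' p hp
      obtain ⟨y, hy⟩ := exists_hasHomogeneousCoords (p := T' p) fun h => hx.ne_zero (by
        rw [← hTT, h, map_zero])
      refine ⟨y, ⟨T' p, hTp, hy⟩, (hi' _ _ hy).unique ?_⟩
      rw [hS, hTT, ← hS']
      exact hi2' _ _ hx
  obtain ⟨e⟩ := nonempty_iso_subvariety_image i hik {x | ∃ p ∈ P, HasHomogeneousCoords x p}
  obtain ⟨e'⟩ := nonempty_iso_subvariety_image i' hik' {x | ∃ p ∈ P', HasHomogeneousCoords x p}
  rw [himage] at e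
  exact ⟨e ≪≫ e'.symm⟩

end LinearMaps

/-! ### Wedging with a linear form and contraction. -/

section Wedge

variable {k V V' : Type*} [Field k] [AddCommGroup V] [Module k V] [AddCommGroup V'] [Module k V']

/-- The exterior product of a linear form with an alternating form. -/
noncomputable def AlternatingMap.wedgeForm {n : ℕ} (l : V →ₗ[k] k) (ω : V [⋀^Fin n]→ₗ[k] k) :
    V [⋀^Fin (n + 1)]→ₗ[k] k :=
  alternatizeUncurryFin (l.smulRight ω)

lemma AlternatingMap.wedgeForm_apply {n : ℕ} (l : V →ₗ[k] k) (ω : V [⋀^Fin n]→ₗ[k] k)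
    (v : Fin (n + 1) → V) :
    wedgeForm l ω v = ∑ i : Fin (n + 1), (-1) ^ (i : ℕ) * (l (v i) * ω (i.removeNth v)) := by
  simp [wedgeForm, alternatizeUncurryFin_apply]

lemma AlternatingMap.wedgeForm_cons {n : ℕ} (l : V →ₗ[k] k) (ω : V [⋀^Fin n]→ₗ[k] k)
    {ε : V} (hε : l ε = 1) (w : Fin n → V) (hw : ∀ j, l (w j) = 0) :
    wedgeForm l ω (Fin.cons ε w) = ω w := by
  rw [wedgeForm_apply, Fin.sum_univ_succ]
  simp [hε, hw]

/-- A top-degree form on `k ε ⊕ V` is determined by its contraction with `ε`. -/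
lemma AlternatingMap.wedgeForm_contraction {n : ℕ} [Module.Finite k V]
    (hn : Module.finrank k V = n) {l : V' →ₗ[k] k} {ε : V'} {ψ : V →ₗ[k] V'} {ρ : V' →ₗ[k] V}
    (hdec : ∀ v, v = l v • ε + ψ (ρ v)) (hlε : l ε = 1) (hlψ : ∀ v, l (ψ v) = 0)
    (hρψ : ∀ v, ρ (ψ v) = v) (ω' : V' [⋀^Fin (n + 1)]→ₗ[k] k) :
    wedgeForm l (((ω'.curryLeft ε).compLinearMap ψ).compLinearMap ρ) = ω' := by
  -- `ε` followed by the image of a basis of `V` is a basis of `V'`, and a top-degree form is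
  -- determined by its value on it.
  let b := Module.finBasisOfFinrankEq k V hn
  have hli : LinearIndependent k (Fin.cons ε (ψ ∘ b) : Fin (n + 1) → V') := by
    rw [linearIndependent_finCons]
    refine ⟨b.linearIndependent.map' ψ (LinearMap.ker_eq_bot_of_inverse
      (LinearMap.ext hρψ : ρ ∘ₗ ψ = LinearMap.id)), fun h => ?_⟩
    have hle : Submodule.span k (Set.range (ψ ∘ b)) ≤ LinearMap.ker l := by
      rw [Submodule.span_le]
      rintro _ ⟨i, rfl⟩
      exact hlψ _
    exact one_ne_zero (hlε.symm.trans (hle h))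
  have hsp : ⊤ ≤ Submodule.span k (Set.range (Fin.cons ε (ψ ∘ b) : Fin (n + 1) → V')) := by
    intro v _
    rw [hdec v]
    refine add_mem (Submodule.smul_mem _ _ (Submodule.subset_span ⟨0, rfl⟩)) ?_
    have h : ρ v ∈ Submodule.span k (Set.range b) := by rw [b.span_eq]; trivial
    have h' := Submodule.mem_map_of_mem (f := ψ) h
    rw [Submodule.map_span, ← Set.range_comp] at h'
    refine Submodule.span_mono ?_ h'
    rintro _ ⟨i, rfl⟩
    exact ⟨i.succ, rfl⟩
  let e := Module.Basis.mk hli hsp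
  rw [← sub_eq_zero, ← AlternatingMap.map_basis_eq_zero_iff e]
  rw [Module.Basis.coe_mk, AlternatingMap.sub_apply, wedgeForm_cons l _ hlε (ψ ∘ b) (fun j => hlψ _),
    sub_eq_zero]
  simp only [compLinearMap_apply, curryLeft_apply_apply, Function.comp_apply, hρψ]
  rfl

end Wedge

/-! ### Length over a local ring and dimension over `k`. -/

section Length

/-- By Nakayama the chain `I + 𝔪ⁿ` drops strictly as long as `𝔪ⁿ ⊄ I`. If `𝔪ᵈ ⊄ I`, this gives a
chain of length `d + 1` from the unit ideal down to `I`, whereas the coheight of `I` is the length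
of `R/I`. -/
lemma Ideal.pow_maximalIdeal_le_of_length_quotient_eq {R : Type*} [CommRing R] [IsLocalRing R]
    [IsNoetherianRing R] {I : Ideal R} {d : ℕ} (h : Module.length R (R ⧸ I) = d) :
    IsLocalRing.maximalIdeal R ^ d ≤ I := by
  set m := IsLocalRing.maximalIdeal R
  have key : ∀ n : ℕ, ¬ m ^ n ≤ I → (n : ℕ∞) ≤ Order.coheight (I ⊔ m ^ n) := by
    intro n
    induction n with
    | zero => simp
    | succ n ih =>
      intro hn
      have hn' : ¬ m ^ n ≤ I := fun h' => hn ((Ideal.pow_le_pow_right n.le_succ).trans h')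
      have hlt : I ⊔ m ^ (n + 1) < I ⊔ m ^ n := by
        refine lt_of_le_of_ne (sup_le_sup_left (Ideal.pow_le_pow_right n.le_succ) _)
          fun heq => hn' ?_
        refine Submodule.le_of_le_smul_of_le_jacobson_bot (I := m)
          (IsNoetherian.noetherian (m ^ n)) (IsLocalRing.maximalIdeal_le_jacobson _) ?_
        rw [smul_eq_mul, ← pow_succ', heq]
        exact le_sup_right
      push_cast
      exact (add_le_add_left (ih hn') 1).trans (Order.coheight_add_one_le hlt)
  by_contra hd
  have h1 : I < I ⊔ m ^ d := left_lt_sup.2 hd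
  have h2 := (add_le_add_left (key d hd) 1).trans (Order.coheight_add_one_le h1)
  rw [← Module.length_quotient, h] at h2
  exact absurd h2 (by exact_mod_cast (Nat.lt_succ_self d).not_ge)

variable (k : Type*) [Field k] {R : Type*} [CommRing R] [Algebra k R] [IsLocalRing R]

lemma IsFiniteLength.length_eq_length_of_residue_bijective
    (hres : Function.Bijective (algebraMap k (IsLocalRing.ResidueField R)))
    {M : Type*} [AddCommGroup M] [Module R M] [Module k M] [IsScalarTower k R M]
    (hM : IsFiniteLength R M) : Module.length k M = Module.length R M := by
  rename_i i1 i2 i3 i4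
  -- The `k`-structure is generalized so that the induction hypothesis applies to the submodule;
  -- each simple factor is the residue field, of dimension one over `k`.
  revert i3 i4
  induction hM with
  | of_subsingleton => intros; simp
  | @of_simple_quotient M _ _ N hsimple _ ih =>
    intro _ _
    rw [Module.length_eq_add_of_exact (R := R) N.subtype N.mkQ N.subtype_injective N.mkQ_surjective
      (LinearMap.exact_subtype_mkQ N), Module.length_eq_add_of_exact (R := k)
      (N.subtype.restrictScalars k) (N.mkQ.restrictScalars k) N.subtype_injective N.mkQ_surjective
      (LinearMap.exact_subtype_mkQ N), ih]
    congr 1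
    obtain ⟨J, hJ, ⟨e⟩⟩ := isSimpleModule_iff_quot_maximal.1 hsimple
    obtain rfl := IsLocalRing.eq_maximalIdeal hJ
    let e' : k ≃ₗ[k] (R ⧸ IsLocalRing.maximalIdeal R) :=
      LinearEquiv.ofBijective (Algebra.linearMap k (IsLocalRing.ResidueField R)) hres
    rw [Module.length_eq_one R, (e.restrictScalars k).length_eq, ← e'.length_eq,
      Module.length_eq_one]

/-- In infinite length, chains of `R`-submodules are chains of `k`-subspaces, so both lengths are
infinite. -/
lemma Module.length_eq_length_of_residue_bijective
    (hres : Function.Bijective (algebraMap k (IsLocalRing.ResidueField R)))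
    (M : Type*) [AddCommGroup M] [Module R M] [Module k M] [IsScalarTower k R M] :
    Module.length k M = Module.length R M := by
  by_cases hM : IsFiniteLength R M
  · exact hM.length_eq_length_of_residue_bijective k hres
  · have h := Submodule.length_le_length_restrictScalars k (⊤ : Submodule R M)
    rw [← Module.length_ne_top_iff, not_not] at hM
    rw [Submodule.restrictScalars_top, Module.length_top, Module.length_top, hM, top_le_iff] at h
    rw [hM, h]

lemma Module.finrank_eq_of_length_eq
    (hres : Function.Bijective (algebraMap k (IsLocalRing.ResidueField R)))
    {M : Type*} [AddCommGroup M] [Module R M] [Module k M] [IsScalarTower k R M]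
    {d : ℕ} (h : Module.length R M = d) : Module.Finite k M ∧ Module.finrank k M = d := by
  have h' := Module.length_eq_length_of_residue_bijective k hres M
  rw [h] at h'
  have hfin : Module.Finite k M := by
    have := (isFiniteLength_iff_isNoetherian_isArtinian.1
      (Module.length_ne_top_iff.1 (h'.trans_ne (ENat.natCast_ne_top d)))).1
    infer_instance
  refine ⟨hfin, ?_⟩
  rw [Module.length_eq_finrank] at h'
  exact_mod_cast h'

end Length

/-! ### Tails of power series and ideals of `k⟦X⟧`. -/

section PowerSeriesTail

variable {k : Type*} [Field k]

/-- The power series `∑ aₙ₊ₑ Xⁿ` obtained from `∑ aₙ Xⁿ`. -/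
noncomputable def PowerSeries.tail (e : ℕ) : k⟦X⟧ →ₗ[k] k⟦X⟧ where
  toFun f := PowerSeries.mk fun n => PowerSeries.coeff (n + e) f
  map_add' f g := by ext; simp
  map_smul' c f := by ext; simp

namespace PowerSeries

@[simp] lemma coeff_tail (e n : ℕ) (f : k⟦X⟧) : coeff n (tail e f) = coeff (n + e) f := by
  simp [tail]

lemma tail_X_pow_mul (e : ℕ) (f : k⟦X⟧) : tail e (X ^ e * f) = f := by
  ext n; simp [coeff_X_pow_mul]

lemma tail_succ (e : ℕ) (f : k⟦X⟧) : tail (e + 1) f = tail 1 (tail e f) := by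
  ext n; simp only [coeff_tail]; congr 2; omega

lemma tail_eq_add (e : ℕ) (f : k⟦X⟧) : tail e f = coeff e f • 1 + X * tail (e + 1) f := by
  ext n
  cases n with
  | zero => simp
  | succ n => simp [coeff_succ_X_mul, coeff_one]; congr 2; omega

lemma X_pow_mul_tail {e : ℕ} {f : k⟦X⟧} (h : X ^ e ∣ f) : X ^ e * tail e f = f := by
  obtain ⟨g, rfl⟩ := h
  rw [tail_X_pow_mul]

lemma exists_mul_eq_X_pow {f : k⟦X⟧} (hf : f ≠ 0) : ∃ n : ℕ, ∃ g, f * g = X ^ n := by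
  refine ⟨f.order.toNat, f.divXPowOrder⁻¹, ?_⟩
  nth_rewrite 1 [← X_pow_order_mul_divXPowOrder (f := f)]
  rw [mul_assoc, PowerSeries.mul_inv_cancel, mul_one]
  rwa [ne_eq, constantCoeff_divXPowOrder_eq_zero_iff]

lemma eq_zero_of_forall_X_pow_dvd {f : k⟦X⟧} (h : ∀ n : ℕ, X ^ n ∣ f) : f = 0 := by
  ext n
  exact X_pow_dvd_iff.1 (h (n + 1)) n n.lt_succ_self

/-- Length `n` forces `Xⁿ ∈ K`, and a strict inclusion of `(Xⁿ)` in `K` would make the length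
smaller than `n`. -/
lemma length_quotient_eq_iff (K : Ideal k⟦X⟧) (n : ℕ) :
    Module.length k⟦X⟧ (k⟦X⟧ ⧸ K) = n ↔ K = Ideal.span {X ^ n} := by
  have hpow (n : ℕ) : Ideal.span {(X : k⟦X⟧) ^ n} = IsLocalRing.maximalIdeal k⟦X⟧ ^ n := by
    rw [maximalIdeal_eq_span_X, Ideal.span_singleton_pow]
  constructor
  · intro h
    have hle := Ideal.pow_maximalIdeal_le_of_length_quotient_eq h
    rw [hpow]
    by_contra hne
    have hlt := lt_of_le_of_ne hle (Ne.symm hne)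
    have h1 := Order.coheight_add_one_le hlt
    rw [← Module.length_quotient, ← Module.length_quotient, h,
      IsDiscreteValuationRing.length_quotient_pow_maximalIdeal] at h1
    exact absurd h1 (by exact_mod_cast (Nat.lt_succ_self n).not_ge)
  · rintro rfl
    rw [hpow, IsDiscreteValuationRing.length_quotient_pow_maximalIdeal]

end PowerSeries

end PowerSeriesTail

/-! ### Finiteness of the normalization and the conductor. -/

namespace Normalization

variable {k : Type u} [Field k] {R : Type v} [CommRing R] [Algebra k R] {s : ℕ}
  (φ : Normalization k R s)

lemma ne_zero_of_mem_nonZeroDivisors {y : Fin s → k⟦X⟧} (hy : y ∈ nonZeroDivisors (Fin s → k⟦X⟧))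
    (i : Fin s) : y i ≠ 0 := by
  intro h
  have h0 : (Pi.single i 1 : Fin s → k⟦X⟧) * y = 0 := by
    ext1 j
    rcases eq_or_ne j i with rfl | hj
    · simp [h]
    · simp [hj]
  have := congrFun ((mem_nonZeroDivisors_iff.1 hy).2 _ h0) i
  simp at this

section Conductor

variable [IsCurveSingularity k R]

lemma constantCoeff_eq_zero_of_mem {r : R} (hr : r ∈ IsLocalRing.maximalIdeal R) (i : Fin s) :
    PowerSeries.constantCoeff (φ.toAlgHom r i) = 0 := by
  by_contra hc
  set c := PowerSeries.constantCoeff (φ.toAlgHom r i)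
  have hu : IsUnit (r - algebraMap k R c) := by
    by_contra h
    have h1 : r - algebraMap k R c ∈ IsLocalRing.maximalIdeal R := h
    have h2 := sub_mem hr h1
    rw [sub_sub_cancel] at h2
    exact h2 ((IsUnit.mk0 c hc).map (algebraMap k R))
  have h3 := (hu.map φ.toAlgHom).map (Pi.evalRingHom (fun _ : Fin s => k⟦X⟧) i)
  have h4 := h3.map PowerSeries.constantCoeff
  simp only [map_sub, AlgHom.commutes, Pi.evalRingHom_apply, Pi.algebraMap_apply] at h4
  rw [PowerSeries.algebraMap_apply] at h4
  simp [c] at h4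

lemma X_pow_dvd_of_mem_pow {r : R} {n : ℕ} (hr : r ∈ IsLocalRing.maximalIdeal R ^ n) (i : Fin s) :
    PowerSeries.X ^ n ∣ φ.toAlgHom r i := by
  have hle : (IsLocalRing.maximalIdeal R).map (φ.branch i) ≤ Ideal.span {PowerSeries.X} := by
    rw [Ideal.map_le_iff_le_comap]
    intro r hr
    rw [Ideal.mem_comap, Ideal.mem_span_singleton, PowerSeries.X_dvd_iff]
    exact φ.constantCoeff_eq_zero_of_mem hr i
  have h := Ideal.mem_map_of_mem (φ.branch i) hr
  rw [Ideal.map_pow] at h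
  have h' := Ideal.pow_right_mono hle n h
  rwa [Ideal.span_singleton_pow, Ideal.mem_span_singleton] at h'

/-- A fraction `a / b` representing `(X, …, X)` has this numerator: the factor `X` makes `a` a
nonunit, as seen on the branch `i₀`. -/
lemma exists_mem_maximalIdeal_forall_ne_zero (i₀ : Fin s) :
    ∃ a ∈ IsLocalRing.maximalIdeal R, ∀ i, φ.toAlgHom a i ≠ 0 := by
  obtain ⟨a, b, hb, hab⟩ := φ.birational fun _ => PowerSeries.X
  have ha (i) : φ.toAlgHom a i = φ.toAlgHom b i * PowerSeries.X := by rw [← hab]; rfl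
  refine ⟨a, fun hu => ?_, fun i => ?_⟩
  · have h := ((hu.map φ.toAlgHom).map (Pi.evalRingHom (fun _ : Fin s => k⟦X⟧) i₀)).map
      PowerSeries.constantCoeff
    simp [ha] at h
  · rw [ha]
    exact mul_ne_zero (ne_zero_of_mem_nonZeroDivisors hb i) PowerSeries.X_ne_zero

/-- The normalization is generated, modulo an element with nonzero components, by finitely many
elements over `k`. -/
lemma exists_spanning_mod {a : Fin s → k⟦X⟧} (ha : ∀ i, a i ≠ 0) :
    ∃ N : ℕ, ∀ z : Fin s → k⟦X⟧, ∃ (c : Fin s × Fin N → k) (w : Fin s → k⟦X⟧),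
      z = ∑ j, c j • (Pi.single j.1 (PowerSeries.X ^ (j.2 : ℕ)) : Fin s → k⟦X⟧) + a * w := by
  choose n g hg using fun i => PowerSeries.exists_mul_eq_X_pow (ha i)
  -- With `aᵢ gᵢ = X ^ nᵢ`, one truncation order `N = ∑ nᵢ` serves all branches: the remainder `X ^
  -- N · tail` is divisible by every `aᵢ`.
  refine ⟨∑ i, n i, fun z => ⟨fun j => PowerSeries.coeff j.2 (z j.1), fun i =>
    g i * PowerSeries.X ^ (∑ i, n i - n i) * PowerSeries.tail (∑ i, n i) (z i), ?_⟩⟩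
  ext1 i
  have hle : n i ≤ ∑ i, n i := Finset.single_le_sum (fun _ _ => Nat.zero_le _) (Finset.mem_univ i)
  set N := ∑ i, n i
  have h1 : a i * (g i * PowerSeries.X ^ (N - n i) * PowerSeries.tail N (z i)) =
      PowerSeries.X ^ N * PowerSeries.tail N (z i) := by
    rw [← mul_assoc, ← mul_assoc, hg, ← pow_add, Nat.add_sub_cancel' hle]
  rw [Pi.add_apply, Pi.mul_apply, h1, Finset.sum_apply, Fintype.sum_prod_type,
    Finset.sum_eq_single i]
  · ext l
    simp only [Pi.smul_apply, Pi.single_eq_same, map_add, map_sum, map_smul,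
      PowerSeries.coeff_X_pow, smul_eq_mul, mul_ite, mul_one, mul_zero,
      PowerSeries.coeff_X_pow_mul', PowerSeries.coeff_tail]
    by_cases hl : N ≤ l
    · rw [Finset.sum_eq_zero fun x _ => if_neg (by have := x.2; omega), if_pos hl,
        Nat.sub_add_cancel hl, zero_add]
    · rw [if_neg hl, add_zero, Finset.sum_eq_single ⟨l, not_le.1 hl⟩]
      · simp
      · intro b _ hb
        exact if_neg fun h => hb (Fin.ext h.symm)
      · simp
  · intro i' _ hi'
    simp [Pi.single_eq_of_ne hi'.symm]
  · simp

/-- The normalization of a curve singularity is a finite module. -/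
lemma exists_finite_generators (i₀ : Fin s) :
    ∃ N : ℕ, ∀ z : Fin s → k⟦X⟧, ∃ r : Fin s × Fin N → R,
      z = ∑ j, φ.toAlgHom (r j) * (Pi.single j.1 (PowerSeries.X ^ (j.2 : ℕ)) : Fin s → k⟦X⟧) := by
  have := IsCurveSingularity.isAdicComplete (k := k) (R := R)
  obtain ⟨a, ham, ha⟩ := φ.exists_mem_maximalIdeal_forall_ne_zero i₀
  obtain ⟨N, hN⟩ := exists_spanning_mod ha
  refine ⟨N, fun z => ?_⟩
  choose c w hcw using hN
  -- Successive approximation: `zs n` is the `n`-th remainder and `p M` collects the coefficients up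
  -- to `a ^ M`. They converge since `R` is complete, and the error vanishes because `X ^ M` divides
  -- it on each branch for all `M`.
  let zs : ℕ → Fin s → k⟦X⟧ := fun n => w^[n] z
  let p : ℕ → Fin s × Fin N → R := fun M j =>
    ∑ n ∈ Finset.range M, algebraMap k R (c (zs n) j) * a ^ n
  have hp (M : ℕ) : z = ∑ j, φ.toAlgHom (p M j) * (Pi.single j.1 (PowerSeries.X ^ (j.2 : ℕ)) :
      Fin s → k⟦X⟧) + φ.toAlgHom a ^ M * zs M := by
    induction M with
    | zero => simp [p, zs]
    | succ M ih =>
      have hz : zs (M + 1) = w (zs M) := Function.iterate_succ_apply' w M z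
      nth_rewrite 1 [ih]
      nth_rewrite 1 [hcw (zs M)]
      simp only [p, Finset.sum_range_succ, map_add, add_mul, Finset.sum_add_distrib, hz, mul_add,
        map_mul, map_pow, AlgHom.commutes, Finset.mul_sum, pow_succ, add_assoc, mul_assoc]
      congr 2
      refine Finset.sum_congr rfl fun j _ => ?_
      rw [Algebra.smul_def]
      ring
  have hlim (j) : ∃ L : R, ∀ n, p n j ≡ L [SMOD (IsLocalRing.maximalIdeal R ^ n • ⊤ : Ideal R)] := by
    refine IsPrecomplete.prec' _ fun {m n} hmn => ?_
    rw [SModEq.sub_mem, smul_eq_mul, Ideal.mul_top]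
    rw [← neg_mem_iff, neg_sub]
    simp only [p]
    rw [Finset.sum_range_sub_sum_range hmn]
    refine sum_mem fun l hl => Ideal.mul_mem_left _ _ ?_
    exact Ideal.pow_le_pow_right (Finset.mem_filter.1 hl).2 (Ideal.pow_mem_pow ham l)
  choose L hL using hlim
  refine ⟨L, ?_⟩
  rw [← sub_eq_zero]
  ext1 i
  refine PowerSeries.eq_zero_of_forall_X_pow_dvd fun M => ?_
  have h1 : z - ∑ j, φ.toAlgHom (L j) * (Pi.single j.1 (PowerSeries.X ^ (j.2 : ℕ)) :
      Fin s → k⟦X⟧) = ∑ j, φ.toAlgHom (p M j - L j) * (Pi.single j.1 (PowerSeries.X ^ (j.2 : ℕ)) :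
      Fin s → k⟦X⟧) + φ.toAlgHom (a ^ M) * zs M := by
    nth_rewrite 1 [hp M]
    simp only [map_sub, sub_mul, Finset.sum_sub_distrib, map_pow]
    ring
  rw [h1, Pi.add_apply, Finset.sum_apply]
  refine dvd_add (Finset.dvd_sum fun j _ => Dvd.dvd.mul_right ?_ _) (Dvd.dvd.mul_right ?_ _)
  · refine φ.X_pow_dvd_of_mem_pow ?_ i
    have := hL j M
    rwa [SModEq.sub_mem, smul_eq_mul, Ideal.mul_top] at this
  · exact φ.X_pow_dvd_of_mem_pow (Ideal.pow_mem_pow ham M) i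

/-- A common denominator `B` of the finitely many generators lies in the conductor ideal, and a
multiple of it is a pure power on the branch `i`. Hence the infimum in `branchConductor` is attained
and is not the default value `0`. -/
lemma exists_mem_conductorIdeal (i : Fin s) :
    ∃ c : ℕ, ∃ r ∈ φ.conductorIdeal, φ.toAlgHom r = Pi.single i (PowerSeries.X ^ c) := by
  obtain ⟨N, hN⟩ := φ.exists_finite_generators i
  choose a b hb hab using fun j : Fin s × Fin N =>
    φ.birational (Pi.single j.1 (PowerSeries.X ^ (j.2 : ℕ)))
  let B : R := ∏ j, b j
  have hB : φ.toAlgHom B ∈ nonZeroDivisors (Fin s → k⟦X⟧) := by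
    simp only [B, map_prod]
    exact prod_mem fun j _ => hb j
  have hBc : ∀ y, φ.toAlgHom B * y ∈ φ.toAlgHom.range := by
    intro y
    obtain ⟨r, rfl⟩ := hN y
    rw [Finset.mul_sum]
    refine sum_mem fun j _ => ?_
    obtain ⟨b', hb'⟩ : b j ∣ B := Finset.dvd_prod_of_mem b (Finset.mem_univ j)
    refine ⟨b' * r j * a j, ?_⟩
    simp only [AlgHom.toRingHom_eq_coe, RingHom.coe_coe, map_mul]
    rw [← hab, hb', map_mul]
    ring
  obtain ⟨c, g, hg⟩ := PowerSeries.exists_mul_eq_X_pow (ne_zero_of_mem_nonZeroDivisors hB i)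
  have hs : φ.toAlgHom B * Pi.single i g = Pi.single i (PowerSeries.X ^ c) := by
    ext1 j
    rcases eq_or_ne j i with rfl | hj
    · simp [hg]
    · simp [hj]
  obtain ⟨r, hr⟩ := hBc (Pi.single i g)
  have hr' : φ.toAlgHom r = φ.toAlgHom B * Pi.single i g := hr
  refine ⟨c, r, fun y => ?_, hr'.trans hs⟩
  rw [hr', mul_assoc]
  exact hBc _

lemma exists_eq_single_X_pow_mul {i : Fin s} {e : ℕ} (he : φ.branchConductor i ≤ e) (g : k⟦X⟧) :
    ∃ r : R, φ.toAlgHom r = Pi.single i (PowerSeries.X ^ e * g) := by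
  obtain ⟨r, hr, hr'⟩ := Nat.sInf_mem (φ.exists_mem_conductorIdeal i)
  obtain ⟨r', h⟩ := hr (Pi.single i (PowerSeries.X ^ (e - φ.branchConductor i) * g))
  refine ⟨r', h.trans ?_⟩
  rw [hr']
  ext1 j
  rcases eq_or_ne j i with rfl | hj
  · rw [Pi.mul_apply, Pi.single_eq_same, Pi.single_eq_same, Pi.single_eq_same, ← mul_assoc]
    change PowerSeries.X ^ φ.branchConductor j * _ * _ = _
    rw [← pow_add, Nat.add_sub_cancel' he]
  · simp [hj]

end Conductor

end Normalization

/-- The linear map on the quotient by an ideal induced by a linear map over a base ring. -/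
def Ideal.liftQuot {k R M : Type*} [CommRing k] [CommRing R] [Algebra k R] [AddCommGroup M]
    [Module k M] (I : Ideal R) (f : R →ₗ[k] M) (hf : ∀ r ∈ I, f r = 0) : (R ⧸ I) →ₗ[k] M :=
  (I.restrictScalars k).liftQ f hf ∘ₗ (Submodule.Quotient.restrictScalarsEquiv k I).symm.toLinearMap

/-! ### The shift along a branch and the correspondence of ideals. -/

namespace Normalization

variable {k : Type u} [Field k] {R : Type v} [CommRing R] [Algebra k R] {s : ℕ}

/-- A `k`-linear embedding `shift` of `R` into itself with one-dimensional cokernel, spanned by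
`ε`, that on the elements of order at least `e` along the `i`-th branch is the multiplication by the
uniformizer of that branch. -/
structure BranchShift (φ : Normalization k R s) (i : Fin s) (e : ℕ) where
  shift : R →ₗ[k] R
  unshift : R →ₗ[k] R
  ε : R
  unshift_shift : ∀ r, unshift (shift r) = r
  coeff_shift : ∀ r, PowerSeries.coeff e (φ.toAlgHom (shift r) i) = 0
  coeff_ε : PowerSeries.coeff e (φ.toAlgHom ε i) = 1
  decomp : ∀ r, r = PowerSeries.coeff e (φ.toAlgHom r i) • ε + shift (unshift r)
  map_shift : ∀ r, PowerSeries.X ^ e ∣ φ.toAlgHom r i →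
    φ.toAlgHom (shift r) =
      (Function.update 1 i PowerSeries.X : Fin s → k⟦X⟧) * φ.toAlgHom r
  dvd_unshift : ∀ r, PowerSeries.X ^ (e + 1) ∣ φ.toAlgHom r i →
    PowerSeries.X ^ e ∣ φ.toAlgHom (unshift r) i

/-- If every element `xᵢᵉ g` of the normalization lies in `R`, then there is a shift. -/
lemma nonempty_branchShift (φ : Normalization k R s) {i : Fin s} {e : ℕ}
    (he : ∀ g : k⟦X⟧, ∃ r : R, φ.toAlgHom r = Pi.single i (PowerSeries.X ^ e * g)) :
    Nonempty (BranchShift φ i e) := by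
  -- The chosen preimages are automatically `k`-linear in `g`, by injectivity of the normalization
  -- map.
  choose G hG using he
  let Gl : k⟦X⟧ →ₗ[k] R :=
    { toFun := G
      map_add' := fun f g => φ.injective (by
        rw [map_add, hG, hG, hG, mul_add, Pi.single_add])
      map_smul' := fun c f => φ.injective (by
        rw [RingHom.id_apply, map_smul, hG, hG, mul_smul_comm, Pi.single_smul]) }
  have hGl (g) : φ.toAlgHom (Gl g) = Pi.single i (PowerSeries.X ^ e * g) := hG g
  have hGli (g) : φ.toAlgHom (Gl g) i = PowerSeries.X ^ e * g := by rw [hGl, Pi.single_eq_same]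
  let β : R →ₗ[k] k⟦X⟧ := LinearMap.proj i ∘ₗ φ.toAlgHom.toLinearMap
  have hβ (r) : φ.toAlgHom r i = β r := rfl
  have hβG (g) : β (Gl g) = PowerSeries.X ^ e * g := hGli g
  let t := PowerSeries.tail (k := k) e
  let t' := PowerSeries.tail (k := k) (e + 1)
  have htX (g) : t (PowerSeries.X ^ e * g) = g := PowerSeries.tail_X_pow_mul e g
  have htt' (f) : t' f = PowerSeries.tail 1 (t f) := PowerSeries.tail_succ e f
  have ht1 (f : k⟦X⟧) : PowerSeries.tail 1 (PowerSeries.X * f) = f := by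
    simpa using PowerSeries.tail_X_pow_mul 1 f
  have htc (f) : PowerSeries.coeff 0 (t f) = PowerSeries.coeff e f := by simp [t]
  have hta (f) : t f = PowerSeries.coeff e f • 1 + PowerSeries.X * t' f :=
    PowerSeries.tail_eq_add e f
  -- Write the `i`-th component as `low + Xᵉ t`. Then `ψ` turns it into `low + Xᵉ⁺¹ t`, while `ρ`
  -- drops the coefficient of `Xᵉ` and moves the higher ones down by one. Other components stay
  -- fixed.
  let ψ : R →ₗ[k] R := LinearMap.id + Gl ∘ₗ (LinearMap.mulLeft k (PowerSeries.X - 1)) ∘ₗ t ∘ₗ β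
  let ρ : R →ₗ[k] R := LinearMap.id + Gl ∘ₗ (t' - t) ∘ₗ β
  have hψ (r) : ψ r = r + Gl ((PowerSeries.X - 1) * t (β r)) := rfl
  have hρ (r) : ρ r = r + Gl (t' (β r) - t (β r)) := rfl
  have htψ (r) : t (β (ψ r)) = PowerSeries.X * t (β r) := by
    rw [hψ, map_add, map_add, hβG, htX]
    ring
  have htρ (r) : t (β (ρ r)) = t' (β r) := by
    rw [hρ, map_add, map_add, hβG, htX]
    ring
  refine ⟨⟨ψ, ρ, Gl 1, fun r => ?_, fun r => ?_, ?_, fun r => ?_, fun r hr => ?_, fun r hr => ?_⟩⟩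
  · rw [hρ, htt', htψ, ht1, hψ, add_assoc, ← map_add]
    ring_nf
    simp
  · rw [hβ, ← htc, htψ]
    simp
  · rw [hGli]
    simp [PowerSeries.coeff_X_pow]
  · rw [hψ (ρ r), htρ, hρ, hβ, ← map_smul]
    have h := hta (β r)
    rw [add_assoc, ← map_add, add_left_comm, ← map_add]
    have h0 : PowerSeries.coeff e (β r) • (1 : k⟦X⟧) +
        (t' (β r) - t (β r) + (PowerSeries.X - 1) * t' (β r)) = 0 := by
      rw [h]; ring
    rw [h0, map_zero, add_zero]
  · have hr' : PowerSeries.X ^ e * t (β r) = β r := PowerSeries.X_pow_mul_tail hr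
    ext1 j
    rw [hψ, map_add, hGl, mul_left_comm, hr', Pi.add_apply, Pi.mul_apply]
    rcases eq_or_ne j i with rfl | hj
    · rw [Pi.single_eq_same, Function.update_self, hβ]
      ring
    · simp [hj]
  · have hr' : PowerSeries.X ^ e * t (β r) = β r :=
      PowerSeries.X_pow_mul_tail ((pow_dvd_pow _ e.le_succ).trans hr)
    rw [hβ, hρ, map_add, hβG, mul_sub, hr', add_sub_cancel]
    exact dvd_mul_right _ _

lemma HasBranchLength.X_pow_dvd {φ : Normalization k R s} {I : Ideal R}
    {a : Fin s → ℕ} (h : φ.HasBranchLength I a) {r : R} (hr : r ∈ I) (i : Fin s) :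
    PowerSeries.X ^ a i ∣ φ.toAlgHom r i := by
  have h1 := (PowerSeries.length_quotient_eq_iff _ _).1 (h i)
  rw [← Ideal.mem_span_singleton, ← h1]
  exact Ideal.mem_map_of_mem (φ.branch i) hr

namespace BranchShift

variable {φ : Normalization k R s} {i : Fin s} {e : ℕ} (S : BranchShift φ i e)

lemma coeff_eq_zero_of_dvd {r : R} (hr : PowerSeries.X ^ (e + 1) ∣ φ.toAlgHom r i) :
    PowerSeries.coeff e (φ.toAlgHom r i) = 0 :=
  PowerSeries.X_pow_dvd_iff.1 hr e e.lt_succ_self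

lemma shift_unshift {r : R} (hr : PowerSeries.X ^ (e + 1) ∣ φ.toAlgHom r i) :
    S.shift (S.unshift r) = r := by
  conv_rhs => rw [S.decomp r, coeff_eq_zero_of_dvd hr, zero_smul, zero_add]

lemma dvd_shift {r : R} (hr : PowerSeries.X ^ e ∣ φ.toAlgHom r i) :
    PowerSeries.X ^ (e + 1) ∣ φ.toAlgHom (S.shift r) i := by
  rw [S.map_shift r hr, Pi.mul_apply, Function.update_self, pow_succ']
  exact mul_dvd_mul_left _ hr

lemma dvd_mul_of_dvd {n : ℕ} (a : R) {r : R} (hr : PowerSeries.X ^ n ∣ φ.toAlgHom r i) :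
    PowerSeries.X ^ n ∣ φ.toAlgHom (a * r) i := by
  rw [map_mul]
  exact hr.mul_left _

/-- The shift is only `k`-linear on `R`, but on elements of order `≥ e` it is multiplication by a
fixed element of the normalization. This is why it carries ideals of such elements to ideals. -/
lemma shift_mul (a : R) {r : R} (hr : PowerSeries.X ^ e ∣ φ.toAlgHom r i) :
    S.shift (a * r) = a * S.shift r :=
  φ.injective (by
    rw [S.map_shift _ (dvd_mul_of_dvd a hr), map_mul, map_mul, S.map_shift r hr]
    ring)

lemma unshift_mul (a : R) {r : R} (hr : PowerSeries.X ^ (e + 1) ∣ φ.toAlgHom r i) :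
    S.unshift (a * r) = a * S.unshift r := by
  rw [← S.unshift_shift (a * S.unshift r), S.shift_mul a (S.dvd_unshift r hr), S.shift_unshift hr]

/-- `J` is the image of `I` under the shift. -/
structure Corr (I J : Ideal R) : Prop where
  dvd_left : ∀ r ∈ I, PowerSeries.X ^ e ∣ φ.toAlgHom r i
  dvd_right : ∀ r ∈ J, PowerSeries.X ^ (e + 1) ∣ φ.toAlgHom r i
  shift_mem : ∀ r ∈ I, S.shift r ∈ J
  unshift_mem : ∀ r ∈ J, S.unshift r ∈ I

lemma exists_corr_right {I : Ideal R} (hI : ∀ r ∈ I, PowerSeries.X ^ e ∣ φ.toAlgHom r i) :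
    ∃ J, S.Corr I J := by
  refine ⟨{ carrier := {r | PowerSeries.X ^ (e + 1) ∣ φ.toAlgHom r i ∧ S.unshift r ∈ I}
            zero_mem' := by simp
            add_mem' := fun {a b} ha hb => ⟨by
              rw [map_add]; exact dvd_add ha.1 hb.1, by rw [map_add]; exact add_mem ha.2 hb.2⟩
            smul_mem' := fun a r hr => ⟨dvd_mul_of_dvd a hr.1, by
              rw [smul_eq_mul, S.unshift_mul a hr.1]; exact I.mul_mem_left a hr.2⟩ },
    hI, fun r hr => hr.1, fun r hr => ⟨S.dvd_shift (hI r hr), ?_⟩, fun r hr => hr.2⟩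
  rwa [S.unshift_shift]

lemma exists_corr_left {J : Ideal R} (hJ : ∀ r ∈ J, PowerSeries.X ^ (e + 1) ∣ φ.toAlgHom r i) :
    ∃ I, S.Corr I J := by
  refine ⟨{ carrier := {r | PowerSeries.X ^ e ∣ φ.toAlgHom r i ∧ S.shift r ∈ J}
            zero_mem' := by simp
            add_mem' := fun {a b} ha hb => ⟨by
              rw [map_add]; exact dvd_add ha.1 hb.1, by rw [map_add]; exact add_mem ha.2 hb.2⟩
            smul_mem' := fun a r hr => ⟨dvd_mul_of_dvd a hr.1, by
              rw [smul_eq_mul, S.shift_mul a hr.1]; exact J.mul_mem_left a hr.2⟩ },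
    fun r hr => hr.1, hJ, fun r hr => hr.2, fun r hr => ⟨S.dvd_unshift r (hJ r hr), ?_⟩⟩
  rwa [S.shift_unshift (hJ r hr)]

namespace Corr

variable {S} {I J : Ideal R}

lemma map_branch (h : S.Corr I J) (j : Fin s) : J.map (φ.branch j) =
    Ideal.span {(Function.update 1 i PowerSeries.X : Fin s → k⟦X⟧) j} * I.map (φ.branch j) := by
  set w := (Function.update 1 i PowerSeries.X : Fin s → k⟦X⟧)
  have hw {r : R} (hr : r ∈ I) : φ.branch j (S.shift r) = w j * φ.branch j r :=
    congrFun (S.map_shift r (h.dvd_left r hr)) j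
  apply le_antisymm
  · rw [Ideal.map_le_iff_le_comap]
    intro r hr
    rw [Ideal.mem_comap, ← S.shift_unshift (h.dvd_right r hr), hw (h.unshift_mem r hr)]
    exact Ideal.mul_mem_mul (Ideal.mem_span_singleton_self _)
      (Ideal.mem_map_of_mem _ (h.unshift_mem r hr))
  · rw [Ideal.map, Ideal.map, Ideal.span_mul_span', Ideal.span_le]
    rintro _ ⟨x, hx, _, ⟨r, hr, rfl⟩, rfl⟩
    obtain rfl : x = w j := hx
    refine Ideal.subset_span ⟨S.shift r, h.shift_mem r hr, hw hr⟩

/-- The extended ideal is multiplied by `(X)` on the branch `i` and unchanged on the others; `(X)`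
can be cancelled in `k⟦X⟧`. -/
lemma hasBranchLength_iff (h : S.Corr I J) (a : Fin s → ℕ) :
    φ.HasBranchLength J (Function.update a i (a i + 1)) ↔ φ.HasBranchLength I a := by
  refine forall_congr' fun j => ?_
  rw [PowerSeries.length_quotient_eq_iff, PowerSeries.length_quotient_eq_iff, h.map_branch]
  rcases eq_or_ne j i with rfl | hj
  · rw [Function.update_self, Function.update_self, pow_succ',
      ← Ideal.span_singleton_mul_span_singleton]
    exact (Ideal.span_singleton_mul_right_injective PowerSeries.X_ne_zero).eq_iff
  · rw [Function.update_of_ne hj, Function.update_of_ne hj, Pi.one_apply, Ideal.span_singleton_one,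
      Ideal.top_mul]

variable (h : S.Corr I J)

/-- The map `R ⧸ I → R ⧸ J` induced by the shift. -/
noncomputable def shiftQuot : (R ⧸ I) →ₗ[k] (R ⧸ J) :=
  I.liftQuot ((Ideal.Quotient.mkₐ k J).toLinearMap ∘ₗ S.shift) fun r hr =>
    Ideal.Quotient.eq_zero_iff_mem.2 (h.shift_mem r hr)

/-- The map `R ⧸ J → R ⧸ I` induced by `unshift`. -/
noncomputable def unshiftQuot : (R ⧸ J) →ₗ[k] (R ⧸ I) :=
  J.liftQuot ((Ideal.Quotient.mkₐ k I).toLinearMap ∘ₗ S.unshift) fun r hr =>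
    Ideal.Quotient.eq_zero_iff_mem.2 (h.unshift_mem r hr)

/-- The linear form on `R ⧸ J` induced by the `e`-th coefficient along the `i`-th branch. -/
noncomputable def coeffQuot : (R ⧸ J) →ₗ[k] k :=
  J.liftQuot (PowerSeries.coeff e ∘ₗ LinearMap.proj i ∘ₗ φ.toAlgHom.toLinearMap) fun r hr =>
    coeff_eq_zero_of_dvd (h.dvd_right r hr)

lemma shiftQuot_mk (r : R) :
    h.shiftQuot (Ideal.Quotient.mk I r) = Ideal.Quotient.mk J (S.shift r) := rfl

lemma unshiftQuot_mk (r : R) :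
    h.unshiftQuot (Ideal.Quotient.mk J r) = Ideal.Quotient.mk I (S.unshift r) := rfl

lemma coeffQuot_mk (r : R) :
    h.coeffQuot (Ideal.Quotient.mk J r) = PowerSeries.coeff e (φ.toAlgHom r i) := rfl

lemma unshiftQuot_shiftQuot (x : R ⧸ I) : h.unshiftQuot (h.shiftQuot x) = x := by
  obtain ⟨r, rfl⟩ := Ideal.Quotient.mk_surjective x
  rw [h.shiftQuot_mk, h.unshiftQuot_mk, S.unshift_shift]

lemma coeffQuot_shiftQuot (x : R ⧸ I) : h.coeffQuot (h.shiftQuot x) = 0 := by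
  obtain ⟨r, rfl⟩ := Ideal.Quotient.mk_surjective x
  rw [h.shiftQuot_mk, h.coeffQuot_mk, S.coeff_shift]

lemma coeffQuot_ε : h.coeffQuot (Ideal.Quotient.mk J S.ε) = 1 := S.coeff_ε

lemma decompQuot (x : R ⧸ J) :
    x = h.coeffQuot x • Ideal.Quotient.mk J S.ε + h.shiftQuot (h.unshiftQuot x) := by
  obtain ⟨r, rfl⟩ := Ideal.Quotient.mk_surjective x
  rw [h.coeffQuot_mk, h.unshiftQuot_mk, h.shiftQuot_mk]
  nth_rewrite 1 [S.decomp r]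
  rw [map_add]
  rfl

/-- The quotient `R ⧸ J` is the sum of `R ⧸ I` and a line. -/
noncomputable def quotEquiv : (R ⧸ J) ≃ₗ[k] k × (R ⧸ I) where
  toLinearMap := h.coeffQuot.prod h.unshiftQuot
  invFun x := x.1 • Ideal.Quotient.mk J S.ε + h.shiftQuot x.2
  left_inv x := (h.decompQuot x).symm
  right_inv x := by
    have hu : h.unshiftQuot (Ideal.Quotient.mk J S.ε) = 0 := by
      have h1 := congrArg h.unshiftQuot (h.decompQuot (Ideal.Quotient.mk J S.ε))
      rw [map_add, h.unshiftQuot_shiftQuot, h.coeffQuot_ε, one_smul] at h1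
      exact left_eq_add.1 h1
    ext1
    · simp [h.coeffQuot_ε, h.coeffQuot_shiftQuot]
    · simp [hu, h.unshiftQuot_shiftQuot]

variable {d : ℕ}

/-- The volume form on `R ⧸ J` attached to a volume form on `R ⧸ I`. -/
noncomputable def formRight (ω : (R ⧸ I) [⋀^Fin d]→ₗ[k] k) : (R ⧸ J) [⋀^Fin (d + 1)]→ₗ[k] k :=
  AlternatingMap.wedgeForm h.coeffQuot (ω.compLinearMap h.unshiftQuot)

/-- The volume form on `R ⧸ I` attached to a volume form on `R ⧸ J`. -/
noncomputable def formLeft (ω' : (R ⧸ J) [⋀^Fin (d + 1)]→ₗ[k] k) : (R ⧸ I) [⋀^Fin d]→ₗ[k] k :=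
  (ω'.curryLeft (Ideal.Quotient.mk J S.ε)).compLinearMap h.shiftQuot

lemma formLeft_formRight (ω : (R ⧸ I) [⋀^Fin d]→ₗ[k] k) : h.formLeft (h.formRight ω) = ω := by
  ext v
  have h1 := AlternatingMap.wedgeForm_cons h.coeffQuot (ω.compLinearMap h.unshiftQuot)
    h.coeffQuot_ε (h.shiftQuot ∘ v) fun j => h.coeffQuot_shiftQuot _
  refine h1.trans ?_
  rw [AlternatingMap.compLinearMap_apply]
  congr 1
  ext1 j
  exact h.unshiftQuot_shiftQuot _

/-- `quotEquiv` is only `k`-linear, so the lengths over `R` are compared as lengths over `k`. -/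
lemma length_quotient [IsCurveSingularity k R] (h : S.Corr I J) :
    Module.length R (R ⧸ J) = Module.length R (R ⧸ I) + 1 := by
  have hres := IsCurveSingularity.residue_bijective (k := k) (R := R)
  rw [← Module.length_eq_length_of_residue_bijective k hres,
    ← Module.length_eq_length_of_residue_bijective k hres, h.quotEquiv.length_eq,
    Module.length_prod, Module.length_eq_one, add_comm]

end Corr

end BranchShift

end Normalization

/-! ### The correspondence in Plücker coordinates. -/

section Plucker

variable {k : Type u} [Field k] {R : Type v} [CommRing R] [Algebra k R] [IsCurveSingularity k R]

/-- The coordinates of an element of `R` with respect to the basis of `R / 𝔪 ^ d` given by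
`frame`. -/
noncomputable def frameCoord (k : Type u) [Field k] {R : Type v} [CommRing R] [Algebra k R]
    [IsCurveSingularity k R] (d : ℕ) (r : R) :
    Fin (Module.finrank k (R ⧸ IsLocalRing.maximalIdeal R ^ d)) → k :=
  (Module.finBasis k (R ⧸ IsLocalRing.maximalIdeal R ^ d)).repr (Ideal.Quotient.mk _ r)

/-- Because `𝔪ᵈ ≤ I`, the frame spans `R/I`, with coefficients that do not depend on `I`. -/
lemma mk_eq_sum_frameCoord {d : ℕ} {I : Ideal R} (hI : IsLocalRing.maximalIdeal R ^ d ≤ I) (r : R) :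
    Ideal.Quotient.mk I r =
      ∑ j, frameCoord k d r j • Ideal.Quotient.mk I (frame k R d j) := by
  have h : Ideal.Quotient.mk (IsLocalRing.maximalIdeal R ^ d) r =
      ∑ j, frameCoord k d r j •
        Ideal.Quotient.mk (IsLocalRing.maximalIdeal R ^ d) (frame k R d j) := by
    have h1 := (Module.finBasis k (R ⧸ IsLocalRing.maximalIdeal R ^ d)).sum_repr
      (Ideal.Quotient.mk _ r)
    rw [← h1]
    refine Finset.sum_congr rfl fun j _ => ?_
    rw [frame, Function.surjInv_eq Ideal.Quotient.mk_surjective]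
    rfl
  have h2 := congrArg (Ideal.Quotient.factorₐ k hI) h
  simpa using h2

/-- The values of a volume form on `R ⧸ I` in terms of its Plücker coordinates. -/
lemma alternatingMap_mk_eq_sum {d : ℕ} {I : Ideal R} (hI : IsLocalRing.maximalIdeal R ^ d ≤ I)
    (ω : (R ⧸ I) [⋀^Fin d]→ₗ[k] k) (v : Fin d → R) :
    ω (fun l => Ideal.Quotient.mk I (v l)) =
      ∑ j : PluckerIndex k R d, (∏ l, frameCoord k d (v l) (j l)) * pluckerCoords k I ω j := by
  have h : (fun l => Ideal.Quotient.mk I (v l)) =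
      fun l => ∑ j, frameCoord k d (v l) j • Ideal.Quotient.mk I (frame k R d j) :=
    funext fun l => mk_eq_sum_frameCoord hI (v l)
  rw [h]
  have h1 := MultilinearMap.map_sum ω.toMultilinearMap
    (fun l j => frameCoord k d (v l) j • Ideal.Quotient.mk I (frame k R d j))
  refine h1.trans (Finset.sum_congr rfl fun j _ => ?_)
  rw [MultilinearMap.map_smul_univ, smul_eq_mul]
  rfl

namespace Normalization.BranchShift

variable {s : ℕ} {φ : Normalization k R s} {i : Fin s} {e : ℕ} (S : BranchShift φ i e)

/-- The map of Plücker coordinates induced by the shift. -/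
noncomputable def pluckerMap (d : ℕ) :
    (PluckerIndex k R d → k) →ₗ[k] (PluckerIndex k R (d + 1) → k) :=
  LinearMap.pi fun j' => ∑ q : Fin (d + 1),
    ((-1) ^ (q : ℕ) * PowerSeries.coeff e (φ.toAlgHom (frame k R (d + 1) (j' q)) i)) •
      ∑ j : PluckerIndex k R d,
        (∏ l, frameCoord k d (S.unshift (frame k R (d + 1) (q.removeNth j' l))) (j l)) •
          LinearMap.proj j

/-- The map of Plücker coordinates inverse to `pluckerMap` on the points of the strata. -/
noncomputable def pluckerMapInv (d : ℕ) :
    (PluckerIndex k R (d + 1) → k) →ₗ[k] (PluckerIndex k R d → k) :=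
  LinearMap.pi fun j => ∑ j' : PluckerIndex k R (d + 1),
    (∏ l, frameCoord k (d + 1)
      ((Fin.cons S.ε fun l => S.shift (frame k R d (j l)) : Fin (d + 1) → R) l) (j' l)) •
        LinearMap.proj j'

namespace Corr

variable {S} {I J : Ideal R} (h : S.Corr I J) {d : ℕ}

/-- Unlike `formLeft_formRight`, this composite is the identity only because `ω'` has top degree;
hence the condition on the length. -/
lemma formRight_formLeft (hI : Module.length R (R ⧸ I) = d)
    (ω' : (R ⧸ J) [⋀^Fin (d + 1)]→ₗ[k] k) : h.formRight (h.formLeft ω') = ω' := by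
  obtain ⟨_, hd⟩ := Module.finrank_eq_of_length_eq k
    (IsCurveSingularity.residue_bijective (k := k) (R := R)) hI
  exact AlternatingMap.wedgeForm_contraction hd h.decompQuot h.coeffQuot_ε h.coeffQuot_shiftQuot
    h.unshiftQuot_shiftQuot ω'

/-- The matrix of `pluckerMap` involves the shift and the frames but not `I`, so one linear map
induces `I ↦ J` on the whole stratum. -/
lemma pluckerMap_pluckerCoords (hI : Module.length R (R ⧸ I) = d)
    (ω : (R ⧸ I) [⋀^Fin d]→ₗ[k] k) :
    S.pluckerMap d (pluckerCoords k I ω) = pluckerCoords k J (h.formRight ω) := by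
  ext j'
  rw [pluckerCoords, formRight, AlternatingMap.wedgeForm_apply]
  simp only [pluckerMap, LinearMap.pi_apply, LinearMap.sum_apply, LinearMap.smul_apply,
    LinearMap.proj_apply, smul_eq_mul]
  refine Finset.sum_congr rfl fun q _ => ?_
  rw [← alternatingMap_mk_eq_sum (Ideal.pow_maximalIdeal_le_of_length_quotient_eq hI) ω, mul_assoc]
  rfl

lemma pluckerMapInv_pluckerCoords (hJ : Module.length R (R ⧸ J) = (d + 1 : ℕ))
    (ω' : (R ⧸ J) [⋀^Fin (d + 1)]→ₗ[k] k) :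
    S.pluckerMapInv d (pluckerCoords k J ω') = pluckerCoords k I (h.formLeft ω') := by
  ext j
  simp only [pluckerMapInv, LinearMap.pi_apply, LinearMap.sum_apply, LinearMap.smul_apply,
    LinearMap.proj_apply, smul_eq_mul]
  rw [← alternatingMap_mk_eq_sum (Ideal.pow_maximalIdeal_le_of_length_quotient_eq hJ) ω']
  rw [pluckerCoords, formLeft, AlternatingMap.compLinearMap_apply,
    AlternatingMap.curryLeft_apply_apply]
  congr 1
  ext1 l
  refine Fin.cases rfl (fun l => rfl) l

end Corr

end Normalization.BranchShift

variable {s : ℕ}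

/-- The Plücker coordinates of the points of a stratum of the punctual Hilbert scheme. -/
def hilbStratumCoords (φ : Normalization k R s) (d : ℕ) (a : Fin s → ℕ) :
    Set (PluckerIndex k R d → k) :=
  {p | ∃ I : Ideal R, Module.length R (R ⧸ I) = d ∧ φ.HasBranchLength I a ∧
    ∃ ω : (R ⧸ I) [⋀^Fin d]→ₗ[k] k, ω ≠ 0 ∧ p = pluckerCoords k I ω}

lemma hilbStratumPoints_eq (φ : Normalization k R s) (d : ℕ) (a : Fin s → ℕ) :
    hilbStratumPoints φ d a = {x | ∃ p ∈ hilbStratumCoords φ d a, HasHomogeneousCoords x p} := by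
  ext x
  constructor
  · rintro ⟨I, hd, ha, ω, hω, hx⟩
    exact ⟨_, ⟨I, hd, ha, ω, hω, rfl⟩, hx⟩
  · rintro ⟨_, ⟨I, hd, ha, ω, hω, rfl⟩, hx⟩
    exact ⟨I, hd, ha, ω, hω, hx⟩

/-- Raising the colength and the length along one branch by one does not change the stratum, once
the length along this branch is at least the conductor. -/
lemma nonempty_iso_hilbStratum [Infinite k] (φ : Normalization k R s) (i : Fin s) (d : ℕ)
    (a : Fin s → ℕ) (hi : φ.branchConductor i ≤ a i) :
    Nonempty (hilbStratum φ d a ≅ hilbStratum φ (d + 1) (Function.update a i (a i + 1))) := by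
  obtain ⟨S⟩ := φ.nonempty_branchShift (φ.exists_eq_single_X_pow_mul hi)
  rw [hilbStratum, hilbStratum, hilbStratumPoints_eq, hilbStratumPoints_eq]
  refine nonempty_iso_subvariety_of_linearMap (S.pluckerMap d) (S.pluckerMapInv d) _ _ ?_ ?_
  · rintro _ ⟨I, hd, ha, ω, hω, rfl⟩
    -- Branch length `a i` puts all of `I` in order `≥ a i`, where the shift is multiplicative.
    obtain ⟨J, h⟩ := S.exists_corr_right (I := I) fun r hr => ha.X_pow_dvd hr i
    have hJ : Module.length R (R ⧸ J) = (d + 1 : ℕ) := by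
      rw [h.length_quotient, hd]
      rfl
    rw [h.pluckerMap_pluckerCoords hd]
    refine ⟨⟨J, hJ, (h.hasBranchLength_iff a).2 ha, h.formRight ω, fun h0 => hω ?_, rfl⟩, ?_⟩
    · rw [← h.formLeft_formRight ω, h0]
      ext v
      rfl
    · rw [h.pluckerMapInv_pluckerCoords hJ, h.formLeft_formRight]
  · rintro _ ⟨J, hJ, ha, ω', hω', rfl⟩
    obtain ⟨I, h⟩ := S.exists_corr_left (J := J) fun r hr => by
      simpa using ha.X_pow_dvd hr i
    have hd : Module.length R (R ⧸ I) = d := by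
      rw [h.length_quotient] at hJ
      exact WithTop.add_right_cancel (ENat.natCast_ne_top 1) hJ
    rw [h.pluckerMapInv_pluckerCoords hJ]
    refine ⟨⟨I, hd, (h.hasBranchLength_iff a).1 ha, h.formLeft ω', fun h0 => hω' ?_, rfl⟩, ?_⟩
    · rw [← h.formRight_formLeft hd ω', h0]
      ext v
      simp [Normalization.BranchShift.Corr.formRight, AlternatingMap.wedgeForm_apply]
    · rw [h.pluckerMap_pluckerCoords hd, h.formRight_formLeft hd]

end Plucker

theorem theorem5p1 {k : Type u} [Field k] [IsAlgClosed k]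
    {R : Type v} [CommRing R] [Algebra k R] [IsCurveSingularity k R]
    {s : ℕ} (φ : Normalization k R (s + 1)) (a' : Fin s → ℕ) (d e : ℕ)
    (he : φ.branchConductor (Fin.last s) ≤ e) :
    K0Var.mk (hilbStratum φ d (Fin.snoc a' e)) =
      K0Var.mk (hilbStratum φ (d + 1) (Fin.snoc a' (e + 1))) := by
  have : Infinite k := IsAlgClosed.instInfinite
  obtain ⟨f⟩ := nonempty_iso_hilbStratum φ (Fin.last s) d (Fin.snoc a' e) (by simpa using he)
  rw [Fin.snoc_last, Fin.update_snoc_last] at f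
  rw [K0Var.mk, K0Var.mk, PreK0.of, PreK0.of, congr_toSkeleton_of_iso f]
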